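/- Fix a field $k$ of characteristic zero. All algebras are associative unital $k$-algebras, all modules and bimodules are $k$-symmetric, and $A^e=A\otimes_kA^{\mathrm{op}}$, so that $A$-bimodules are the same as left $A^e$-modules. For an $A$-bimodule $M$ let $H^n(A,M)=\mathrm{Ext}^n_{A^e}(A,M)$ and $H_n(A,M)=\mathrm{Tor}_n^{A^e}(A,M)$ (both zero for $n<0$). An $A$-bimodule $U$ is invertible if there is an $A$-bimodule $Q$ with $U\otimes_AQ\cong A\cong Q\otimes_AU$ as bimodules. Let $d$ be an integer. We say that $A\in VdB(d)$ with dualizing bimodule $U$ if $A$ has a resolution by finitely generated projective $A^e$-modules, $U$ is an invertible $A$-bimodule, and the following condition holds, in either of its two forms: (1) for every $n$ there is an isomorphism $H^{n}(A,M)\cong H_{d-n}(A,U\otimes_AM)$, $k$-linear and natural in the $A$-bimodule $M$; (2) $A$ has finite projective dimension as an $A^e$-module, $\mathrm{Ext}^n_{A^e}(A,A^e)=0$ for $n\neq d$, and $\mathrm{Ext}^d_{A^e}(A,A^e)\cong U$ as $A$-bimodules, where the bimodule structure on $\mathrm{Ext}$ comes from right multiplication of $A^e$ on itself. **Theorem (localization).**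 Let $A\to B$ be a morphism of $k$-algebras and $U$ an $A$-bimodule such that (i) the functors $B\otimes_A-$ (on left $A$-modules) and $-\otimes_AB$ (on right $A$-modules) are exact; (ii) the canonical map $B\otimes_AB\to B$ induced by multiplication is an isomorphism; (iii) $B\otimes_AU\cong U\otimes_AB$ as $A$-bimodules. If $A\in VdB(d)$ with dualizing bimodule $U$, then $B\in VdB(d)$ with dualizing bimodule $B\otimes_AU\otimes_AB$. This holds for each of the two forms of the definition: if $A$ satisfies it with (1), so does $B$, and if $A$ satisfies it with (2), so does $B$. Moreover $B\otimes_AU\cong B\otimes_AU\otimes_AB$ as $B$-$A$-bimodules, so that the dualizing bimodule of $B$ is $B\otimes_AU$ with the right $B$-action transported along this isomorphism. -/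

import Mathlib

open CategoryTheory TensorProduct MulOpposite
open scoped ModuleCat

universe w u

noncomputable section

namespace VdB

/-! ### Balanced tensor products over a noncommutative ring -/

section BalTensor

variable {k : Type w} [Field k] {ι : Type*}
  {N M N' M' N'' M'' : Type u}
  [AddCommGroup N] [Module k N] [AddCommGroup M] [Module k M]
  [AddCommGroup N'] [Module k N'] [AddCommGroup M'] [Module k M']
  [AddCommGroup N''] [Module k N''] [AddCommGroup M''] [Module k M'']

/-- The subspace of `N ⊗[k] M` spanned by all `(n · i) ⊗ m - n ⊗ (i · m)`. -/
def balRel (ρ : ι → Module.End k N) (σ : ι → Module.End k M) : Submodule k (N ⊗[k] M) :=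
  Submodule.span k {t | ∃ (i : ι) (n : N) (m : M), t = ρ i n ⊗ₜ[k] m - n ⊗ₜ[k] σ i m}

/-- The balanced tensor product: if `ι` is a `k`-algebra `R`, `ρ` a right action of `R` on `N` and
`σ` a left action of `R` on `M`, this is the `k`-vector space `N ⊗_R M`. -/
def BalTensor (ρ : ι → Module.End k N) (σ : ι → Module.End k M) : Type u :=
  (N ⊗[k] M) ⧸ balRel ρ σ

namespace BalTensor

variable {ρ : ι → Module.End k N} {σ : ι → Module.End k M}
  {ρ' : ι → Module.End k N'} {σ' : ι → Module.End k M'}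
  {ρ'' : ι → Module.End k N''} {σ'' : ι → Module.End k M''}

instance : AddCommGroup (BalTensor ρ σ) :=
  inferInstanceAs (AddCommGroup ((N ⊗[k] M) ⧸ balRel ρ σ))

instance : Module k (BalTensor ρ σ) :=
  inferInstanceAs (Module k ((N ⊗[k] M) ⧸ balRel ρ σ))

variable (ρ σ) in
/-- The quotient map `N ⊗_k M → N ⊗_R M`. -/
def mk : N ⊗[k] M →ₗ[k] BalTensor ρ σ := (balRel ρ σ).mkQ

lemma mk_surjective : Function.Surjective (mk ρ σ) := (balRel ρ σ).mkQ_surjective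

lemma mk_rel (i : ι) (n : N) (m : M) : mk ρ σ (ρ i n ⊗ₜ m) = mk ρ σ (n ⊗ₜ σ i m) :=
  (Submodule.Quotient.eq _).2 (Submodule.subset_span ⟨i, n, m, rfl⟩)

@[ext]
lemma hom_ext {P : Type*} [AddCommGroup P] [Module k P] {f g : BalTensor ρ σ →ₗ[k] P}
    (h : ∀ n m, f (mk ρ σ (n ⊗ₜ m)) = g (mk ρ σ (n ⊗ₜ m))) : f = g := by
  have h' : f ∘ₗ mk ρ σ = g ∘ₗ mk ρ σ := TensorProduct.ext' h
  ext x
  obtain ⟨t, rfl⟩ := mk_surjective x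
  exact LinearMap.congr_fun h' t

/-- A linear map out of a balanced tensor product, from a balanced one on `N ⊗_k M`. -/
def lift {P : Type*} [AddCommGroup P] [Module k P] (f : N ⊗[k] M →ₗ[k] P)
    (hf : ∀ i n m, f (ρ i n ⊗ₜ m) = f (n ⊗ₜ σ i m)) : BalTensor ρ σ →ₗ[k] P :=
  (balRel ρ σ).liftQ f (Submodule.span_le.2 (by
    rintro _ ⟨i, n, m, rfl⟩
    simp [hf i n m]))

@[simp]
lemma lift_mk {P : Type*} [AddCommGroup P] [Module k P] (f : N ⊗[k] M →ₗ[k] P)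
    (hf : ∀ i n m, f (ρ i n ⊗ₜ m) = f (n ⊗ₜ σ i m)) (t : N ⊗[k] M) :
    lift f hf (mk ρ σ t) = f t := rfl

/-- The map `f ⊗ g` induced by equivariant maps `f` and `g`. -/
def map (f : N →ₗ[k] N') (g : M →ₗ[k] M') (hf : ∀ i n, f (ρ i n) = ρ' i (f n))
    (hg : ∀ i m, g (σ i m) = σ' i (g m)) : BalTensor ρ σ →ₗ[k] BalTensor ρ' σ' :=
  lift (mk ρ' σ' ∘ₗ TensorProduct.map f g) (fun i n m => by simp [hf, hg, mk_rel])

@[simp]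
lemma map_mk (f : N →ₗ[k] N') (g : M →ₗ[k] M') (hf : ∀ i n, f (ρ i n) = ρ' i (f n))
    (hg : ∀ i m, g (σ i m) = σ' i (g m)) (n : N) (m : M) :
    map f g hf hg (mk ρ σ (n ⊗ₜ m)) = mk ρ' σ' (f n ⊗ₜ g m) := rfl

end BalTensor

end BalTensor

/-! ### Bimodules -/

/-- The category of `k`-symmetric `A`-`B`-bimodules, that is, of left modules over `A ⊗ Bᵒᵖ`. -/
abbrev BimodCat (k : Type w) [Field k] (A B : Type u) [Ring A] [Algebra k A] [Ring B]
    [Algebra k B] : Type (u + 1) :=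
  ModuleCat.{u} (A ⊗[k] Bᵐᵒᵖ)

section Bimodules

variable {k : Type w} [Field k] {A B C A' B' : Type u}
  [Ring A] [Algebra k A] [Ring B] [Algebra k B] [Ring C] [Algebra k C]
  [Ring A'] [Algebra k A'] [Ring B'] [Algebra k B']

/-- The action of `A ⊗ Bᵒᵖ` on a bimodule, as an algebra map to its `k`-linear endomorphisms. -/
def act (X : BimodCat k A B) : A ⊗[k] Bᵐᵒᵖ →ₐ[k] Module.End k X :=
  Algebra.lsmul k k X

/-- The left action `x ↦ a x` on an `A`-`B`-bimodule. -/
def leftAct (X : BimodCat k A B) (a : A) : Module.End k X := act X (a ⊗ₜ 1)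

/-- The right action `x ↦ x b` on an `A`-`B`-bimodule. -/
def rightAct (X : BimodCat k A B) (b : B) : Module.End k X := act X (1 ⊗ₜ op b)

/-- A morphism of bimodules as a `k`-linear map. -/
def klin {X Y : BimodCat k A B} (f : X ⟶ Y) : X →ₗ[k] Y := f.hom.restrictScalars k

lemma klin_act {X Y : BimodCat k A B} (f : X ⟶ Y) (r : A ⊗[k] Bᵐᵒᵖ) (x : X) :
    klin f (act X r x) = act Y r (klin f x) := f.hom.map_smul r x

lemma leftAct_rightAct (X : BimodCat k A B) (a : A) (b : B) (x : X) :
    leftAct X a (rightAct X b x) = rightAct X b (leftAct X a x) := by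
  simp only [leftAct, rightAct, ← Module.End.mul_apply, ← map_mul,
    Algebra.TensorProduct.tmul_mul_tmul, one_mul, mul_one]

/-- The underlying `k`-vector space of `X ⊗_B Y`. -/
abbrev TensorCarrier (X : BimodCat k A B) (Y : BimodCat k B C) : Type u :=
  BalTensor (k := k) (rightAct X) (leftAct Y)

/-- The left action of `A` on `X ⊗_B Y`: `a (x ⊗ y) = (a x) ⊗ y`. -/
def tensorLeftAct (X : BimodCat k A B) (Y : BimodCat k B C) :
    A →ₐ[k] Module.End k (TensorCarrier X Y) :=
  AlgHom.ofLinearMap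
    { toFun := fun a => BalTensor.map (leftAct X a) LinearMap.id
        (fun b x => leftAct_rightAct X a b x) (fun _ _ => rfl)
      map_add' := fun a a' => by
        ext x y
        simp [leftAct, add_tmul]
      map_smul' := fun c a => by
        ext x y
        simp only [leftAct, ← smul_tmul', map_smul, BalTensor.map_mk, LinearMap.smul_apply,
          LinearMap.id_coe, id_eq, RingHom.id_apply] }
    (by ext x y; simp [leftAct, ← Algebra.TensorProduct.one_def])
    (fun a a' => by
      ext x y
      simp only [leftAct, LinearMap.coe_mk, AddHom.coe_mk, BalTensor.map_mk, LinearMap.id_coe,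
        id_eq, Module.End.mul_apply]
      rw [← Module.End.mul_apply, ← map_mul, Algebra.TensorProduct.tmul_mul_tmul, one_mul])

/-- The right action of `C` on `X ⊗_B Y`: `(x ⊗ y) c = x ⊗ (y c)`. -/
def tensorRightAct (X : BimodCat k A B) (Y : BimodCat k B C) :
    Cᵐᵒᵖ →ₐ[k] Module.End k (TensorCarrier X Y) :=
  AlgHom.ofLinearMap
    { toFun := fun c => BalTensor.map LinearMap.id (rightAct Y c.unop)
        (fun _ _ => rfl) (fun b y => (leftAct_rightAct Y b c.unop y).symm)
      map_add' := fun a a' => by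
        ext x y
        simp [rightAct, tmul_add]
      map_smul' := fun c a => by
        ext x y
        simp [rightAct] }
    (by ext x y; simp [rightAct, ← Algebra.TensorProduct.one_def])
    (fun a a' => by
      ext x y
      simp only [rightAct, LinearMap.coe_mk, AddHom.coe_mk, BalTensor.map_mk, LinearMap.id_coe,
        id_eq, Module.End.mul_apply, op_unop]
      rw [← Module.End.mul_apply, ← map_mul, Algebra.TensorProduct.tmul_mul_tmul, one_mul])

lemma tensorLeftAct_commute (X : BimodCat k A B) (Y : BimodCat k B C) (a : A) (c : Cᵐᵒᵖ) :
    Commute (tensorLeftAct X Y a) (tensorRightAct X Y c) :=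
  BalTensor.hom_ext fun _ _ => rfl

/-- The action of `A ⊗ Cᵒᵖ` on `X ⊗_B Y`: `(a ⊗ c) (x ⊗ y) = (a x) ⊗ (y c)`. -/
def tensorAct (X : BimodCat k A B) (Y : BimodCat k B C) :
    A ⊗[k] Cᵐᵒᵖ →ₐ[k] Module.End k (TensorCarrier X Y) :=
  Algebra.TensorProduct.lift (tensorLeftAct X Y) (tensorRightAct X Y) (tensorLeftAct_commute X Y)

lemma tensorAct_tmul (X : BimodCat k A B) (Y : BimodCat k B C) (a : A) (c : Cᵐᵒᵖ) (x : X) (y : Y) :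
    tensorAct X Y (a ⊗ₜ c) (BalTensor.mk (rightAct X) (leftAct Y) (x ⊗ₜ y))
      = BalTensor.mk (rightAct X) (leftAct Y) (leftAct X a x ⊗ₜ rightAct Y c.unop y) := by
  rw [tensorAct, Algebra.TensorProduct.lift_tmul]
  rfl

instance (X : BimodCat k A B) (Y : BimodCat k B C) :
    Module (A ⊗[k] Cᵐᵒᵖ) (TensorCarrier X Y) :=
  Module.compHom _ (tensorAct X Y).toRingHom

/-- The `A`-`C`-bimodule `X ⊗_B Y`. -/
def tensor (X : BimodCat k A B) (Y : BimodCat k B C) : BimodCat k A C :=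
  ModuleCat.of (A ⊗[k] Cᵐᵒᵖ) (TensorCarrier X Y)

/-- The map `id ⊗ g : X ⊗_B Y → X ⊗_B Y'`, as a `k`-linear map. -/
def tensorMapLin (X : BimodCat k A B) {Y Y' : BimodCat k B C} (g : Y ⟶ Y') :
    TensorCarrier X Y →ₗ[k] TensorCarrier X Y' :=
  BalTensor.map LinearMap.id (klin g) (fun _ _ => rfl) (fun _ _ => klin_act g _ _)

lemma tensorMapLin_act (X : BimodCat k A B) {Y Y' : BimodCat k B C} (g : Y ⟶ Y')
    (r : A ⊗[k] Cᵐᵒᵖ) (t : TensorCarrier X Y) :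
    tensorMapLin X g (tensorAct X Y r t) = tensorAct X Y' r (tensorMapLin X g t) := by
  induction r using TensorProduct.induction_on with
  | zero => simp
  | add r s hr hs => simp only [map_add, LinearMap.add_apply, hr, hs]
  | tmul a c =>
    suffices h : tensorMapLin X g ∘ₗ tensorAct X Y (a ⊗ₜ c) =
        tensorAct X Y' (a ⊗ₜ c) ∘ₗ tensorMapLin X g from LinearMap.congr_fun h t
    refine BalTensor.hom_ext fun x y => ?_
    have h1 : ∀ (x : X) (y : Y),
        tensorMapLin X g (BalTensor.mk (rightAct X) (leftAct Y) (x ⊗ₜ y)) =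
          BalTensor.mk (rightAct X) (leftAct Y') (x ⊗ₜ klin g y) := fun _ _ => rfl
    have h2 : klin g (rightAct Y c.unop y) = rightAct Y' c.unop (klin g y) := klin_act g _ _
    rw [LinearMap.comp_apply, LinearMap.comp_apply, tensorAct_tmul, h1, h1, tensorAct_tmul, h2]

/-- The map `id ⊗ g : X ⊗_B Y → X ⊗_B Y'`, as a map of bimodules. -/
def tensorMap (X : BimodCat k A B) {Y Y' : BimodCat k B C} (g : Y ⟶ Y') :
    tensor X Y ⟶ tensor X Y' :=
  ModuleCat.ofHom
    { toFun := tensorMapLin X g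
      map_add' := (tensorMapLin X g).map_add
      map_smul' := tensorMapLin_act X g }

/-- The functor `X ⊗_B -` from `B`-`C`-bimodules to `A`-`C`-bimodules. -/
def tensorFunctor (C : Type u) [Ring C] [Algebra k C] (X : BimodCat k A B) :
    BimodCat k B C ⥤ BimodCat k A C where
  obj Y := tensor X Y
  map g := tensorMap X g
  map_id Y := by
    have h : tensorMapLin X (𝟙 Y) = LinearMap.id := BalTensor.hom_ext fun _ _ => rfl
    apply ModuleCat.hom_ext
    exact LinearMap.ext fun t => LinearMap.congr_fun h t
  map_comp g g' := by
    have h : tensorMapLin X (g ≫ g') = tensorMapLin X g' ∘ₗ tensorMapLin X g :=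
      BalTensor.hom_ext fun _ _ => rfl
    apply ModuleCat.hom_ext
    exact LinearMap.ext fun t => LinearMap.congr_fun h t

/-- Restriction of an `A`-`B`-bimodule to an `A'`-`B'`-bimodule along algebra maps. -/
def restrict (φ : A' →ₐ[k] A) (ψ : B' →ₐ[k] B) (X : BimodCat k A B) : BimodCat k A' B' :=
  (ModuleCat.restrictScalars (Algebra.TensorProduct.map φ (AlgHom.op ψ)).toRingHom).obj X

variable (k A) in
/-- The algebra `A` as an `A`-bimodule, `(a ⊗ b) x = a x b`. -/
def regular : BimodCat k A A :=
  letI : Module (A ⊗[k] Aᵐᵒᵖ) A := TensorProduct.Algebra.module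
  ModuleCat.of (A ⊗[k] Aᵐᵒᵖ) A

/-- A bimodule `P` is invertible if `P ⊗_A Q ≅ A ≅ Q ⊗_A P` for some bimodule `Q`. -/
def IsInvertible (P : BimodCat k A A) : Prop :=
  ∃ Q : BimodCat k A A,
    Nonempty (tensor P Q ≅ regular k A) ∧ Nonempty (tensor Q P ≅ regular k A)

end Bimodules

/-! ### Hochschild homology and cohomology -/

section Hochschild

variable (k : Type w) [Field k] (A : Type u) [Ring A] [Algebra k A]

/-- The isomorphism `A^e ≅ (A^e)ᵒᵖ`, `b ⊗ a ↦ a ⊗ b`, which identifies bimodules (left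
`A^e`-modules) with right `A^e`-modules: `x · (a ⊗ b) = b x a`. -/
def envSwap : A ⊗[k] Aᵐᵒᵖ ≃ₐ[k] (A ⊗[k] Aᵐᵒᵖ)ᵐᵒᵖ :=
  (Algebra.TensorProduct.comm k A Aᵐᵒᵖ).trans
    ((Algebra.TensorProduct.congr AlgEquiv.refl (AlgEquiv.opOp k A)).trans
      (Algebra.TensorProduct.opAlgEquiv k k A Aᵐᵒᵖ))

lemma envSwap_tmul (a b : A) : envSwap k A (b ⊗ₜ op a) = op (a ⊗ₜ op b) := rfl

variable {k A}

/-- The vector space `X ⊗_{A^e} M`, where the bimodule `X` is seen as a right `A^e`-module. -/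
abbrev EnvTensor (X M : BimodCat k A A) : Type u :=
  BalTensor (k := k) (ι := A ⊗[k] Aᵐᵒᵖ) (fun r => act X ((envSwap k A).symm (op r)))
    (fun r => act M r)

/-- The map `f ⊗ g : X ⊗_{A^e} M → X' ⊗_{A^e} M'`. -/
def envTensorMap {X X' M M' : BimodCat k A A} (f : X ⟶ X') (g : M ⟶ M') :
    EnvTensor X M →ₗ[k] EnvTensor X' M' :=
  BalTensor.map (klin f) (klin g) (fun _ _ => klin_act f _ _) (fun _ _ => klin_act g _ _)

/-- The functor `- ⊗_{A^e} M`. -/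
def envTensorFunctor (M : BimodCat k A A) : BimodCat k A A ⥤ ModuleCat.{u} k where
  obj X := ModuleCat.of k (EnvTensor X M)
  map f := ModuleCat.ofHom (envTensorMap f (𝟙 M))
  map_id X := by
    apply ModuleCat.hom_ext
    apply BalTensor.hom_ext
    intro x m
    rfl
  map_comp f g := by
    apply ModuleCat.hom_ext
    apply BalTensor.hom_ext
    intro x m
    rfl

instance (M : BimodCat k A A) : (envTensorFunctor M).Additive where
  map_add {X Y f g} := by
    apply ModuleCat.hom_ext
    apply BalTensor.hom_ext
    intro x m
    change BalTensor.mk _ _ ((klin f x + klin g x) ⊗ₜ m) = _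
    rw [add_tmul, map_add]
    rfl

/-- The natural transformation `- ⊗_{A^e} M → - ⊗_{A^e} M'` induced by `g : M → M'`. -/
def envTensorNat {M M' : BimodCat k A A} (g : M ⟶ M') :
    envTensorFunctor M ⟶ envTensorFunctor M' where
  app X := ModuleCat.ofHom (envTensorMap (𝟙 X) g)
  naturality X Y f := by
    apply ModuleCat.hom_ext
    apply BalTensor.hom_ext
    intro x m
    rfl

variable (k A)

/-- Hochschild homology `H_n(A, M) = Tor_n^{A^e}(A, M)`, as a functor of the bimodule `M`; `Tor` is
the left derived functor of `- ⊗_{A^e} M`. -/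
def hochschildHomology (n : ℕ) : BimodCat k A A ⥤ ModuleCat.{u} k where
  obj M := ((envTensorFunctor M).leftDerived n).obj (regular k A)
  map g := (NatTrans.leftDerived (envTensorNat g) n).app (regular k A)
  map_id M := by
    have h : envTensorNat (𝟙 M) = 𝟙 (envTensorFunctor M) := by
      ext X : 2
      exact (envTensorFunctor M).map_id X
    rw [h, NatTrans.leftDerived_id]
    rfl
  map_comp {M M' M''} g h := by
    have e : envTensorNat (g ≫ h) = envTensorNat g ≫ envTensorNat h := by
      ext X : 2
      apply ModuleCat.hom_ext
      apply BalTensor.hom_ext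
      intro x m
      rfl
    rw [e, NatTrans.leftDerived_comp]
    rfl

/-- Hochschild cohomology `H^n(A, M) = Ext^n_{A^e}(A, M)`, as a functor of the bimodule `M`. -/
def hochschildCohomology (n : ℕ) : BimodCat k A A ⥤ ModuleCat.{u} k where
  obj M := ModuleCat.of k (Abelian.Ext.{u} (regular k A) M n)
  map {M M'} g := ModuleCat.ofHom
    ((Abelian.Ext.mk₀ g).postcompOfLinear k (regular k A) (add_zero n))
  map_id M := by
    ext e
    exact Abelian.Ext.comp_mk₀_id e
  map_comp {M M' M''} g h := by
    ext e
    change e.comp (Abelian.Ext.mk₀ (g ≫ h)) (add_zero n) =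
      (e.comp (Abelian.Ext.mk₀ g) (add_zero n)).comp (Abelian.Ext.mk₀ h) (add_zero n)
    rw [← Abelian.Ext.mk₀_comp_mk₀, Abelian.Ext.comp_assoc_of_third_deg_zero]

end Hochschild

/-! ### The bimodule `Ext^n_{A^e}(A, A^e)` -/

section ExtBimodule

/-- Right multiplication by `r`, as an endomorphism of the left `R`-module `R`. -/
def rightMulHom (R : Type u) [Ring R] (r : R) : ModuleCat.of R R ⟶ ModuleCat.of R R :=
  ModuleCat.ofHom (LinearMap.toSpanSingleton R R r)

/-- For a left `R`-module `X`, the group `Ext^n_R(X, R)` is a right `R`-module, through right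
multiplication on the second argument. -/
instance extRightModule (R : Type u) [Ring R] (X : ModuleCat.{u} R) (n : ℕ) :
    Module Rᵐᵒᵖ (Abelian.Ext.{u} X (ModuleCat.of R R) n) where
  smul r e := e.comp (Abelian.Ext.mk₀ (rightMulHom R r.unop)) (add_zero n)
  one_smul e := by
    change e.comp (Abelian.Ext.mk₀ (rightMulHom R 1)) _ = e
    have : rightMulHom R 1 = 𝟙 _ := by
      ext
      simp [rightMulHom]
    rw [this, Abelian.Ext.comp_mk₀_id]
  mul_smul r s e := by
    change e.comp (Abelian.Ext.mk₀ (rightMulHom R (s.unop * r.unop))) _ =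
      (e.comp (Abelian.Ext.mk₀ (rightMulHom R s.unop)) _).comp
        (Abelian.Ext.mk₀ (rightMulHom R r.unop)) _
    have : rightMulHom R (s.unop * r.unop) = rightMulHom R s.unop ≫ rightMulHom R r.unop := by
      ext
      simp [rightMulHom]
    rw [this, ← Abelian.Ext.mk₀_comp_mk₀, Abelian.Ext.comp_assoc_of_third_deg_zero]
  smul_zero r := by
    change Abelian.Ext.comp 0 (Abelian.Ext.mk₀ (rightMulHom R r.unop)) (add_zero n) = 0
    rw [Abelian.Ext.zero_comp]
  smul_add r e f := by
    change (e + f).comp (Abelian.Ext.mk₀ (rightMulHom R r.unop)) (add_zero n) = _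
    rw [Abelian.Ext.add_comp]
    rfl
  add_smul r s e := by
    change e.comp (Abelian.Ext.mk₀ (rightMulHom R (r.unop + s.unop))) _ =
      e.comp (Abelian.Ext.mk₀ (rightMulHom R r.unop)) _ +
        e.comp (Abelian.Ext.mk₀ (rightMulHom R s.unop)) _
    have : rightMulHom R (r.unop + s.unop) = rightMulHom R r.unop + rightMulHom R s.unop := by
      ext
      simp [rightMulHom]
    rw [this, Abelian.Ext.mk₀_add, Abelian.Ext.comp_add]
  zero_smul e := by
    change e.comp (Abelian.Ext.mk₀ (rightMulHom R 0)) _ = 0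
    have : rightMulHom R 0 = 0 := by
      ext
      simp [rightMulHom]
    rw [this, Abelian.Ext.mk₀_zero, Abelian.Ext.comp_zero]

variable (k : Type w) [Field k] (A : Type u) [Ring A] [Algebra k A]

/-- `A^e` as a left module over itself. -/
abbrev envRegular : BimodCat k A A := ModuleCat.of (A ⊗[k] Aᵐᵒᵖ) (A ⊗[k] Aᵐᵒᵖ)

/-- The `A`-bimodule `Ext^n_{A^e}(A, A^e)`, whose bimodule structure is induced by the right
multiplication of `A^e` on itself: `b e a = e · (a ⊗ b)`. -/
def extBimodule (n : ℕ) : BimodCat k A A :=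
  letI : Module (A ⊗[k] Aᵐᵒᵖ) (Abelian.Ext.{u} (regular k A) (envRegular k A) n) :=
    Module.compHom _ (envSwap k A : A ⊗[k] Aᵐᵒᵖ →+* (A ⊗[k] Aᵐᵒᵖ)ᵐᵒᵖ)
  ModuleCat.of (A ⊗[k] Aᵐᵒᵖ) (Abelian.Ext.{u} (regular k A) (envRegular k A) n)

end ExtBimodule

/-! ### The class `VdB(d)` -/

section Duality

variable (k : Type w) [Field k] (A : Type u) [Ring A] [Algebra k A]

/-- `A` admits a resolution by finitely generated projective `A^e`-modules. -/
def HasFGProjectiveResolution : Prop :=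
  ∃ P : ProjectiveResolution (regular k A), ∀ n, Module.Finite (A ⊗[k] Aᵐᵒᵖ) (P.complex.X n)

variable {k A}

/-- `H^•(A, M) ≅ H_{d-•}(A, U ⊗_A M)`, naturally in the bimodule `M`; both sides vanish in
negative degrees. -/
structure SatisfiesDuality (U : BimodCat k A A) (d : ℤ) : Prop where
  iso : ∀ n j : ℕ, (n : ℤ) + j = d →
    Nonempty (hochschildCohomology k A n ≅ tensorFunctor A U ⋙ hochschildHomology k A j)
  cohomology_zero : ∀ n : ℕ, d < n → ∀ M : BimodCat k A A,
    Subsingleton ((hochschildCohomology k A n).obj M)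
  homology_zero : ∀ j : ℕ, d < j → ∀ M : BimodCat k A A,
    Subsingleton ((hochschildHomology k A j).obj (tensor U M))

/-- `A` has finite projective dimension over `A^e`, and `Ext^n_{A^e}(A, A^e)` is zero for `n ≠ d`
and isomorphic to the bimodule `U` for `n = d`. -/
structure SatisfiesExt (U : BimodCat k A A) (d : ℤ) : Prop where
  finite_dim : ∃ n : ℕ, HasProjectiveDimensionLE (regular k A) n
  ext_zero : ∀ n : ℕ, (n : ℤ) ≠ d → Subsingleton (extBimodule k A n)
  ext_iso : ∀ n : ℕ, (n : ℤ) = d → Nonempty (extBimodule k A n ≅ U)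

/-- `A ∈ VdB(d)` with dualizing bimodule `U`, the class being described by the duality between
Hochschild homology and cohomology. -/
structure InVdBDuality (U : BimodCat k A A) (d : ℤ) : Prop where
  resolution : HasFGProjectiveResolution k A
  invertible : IsInvertible U
  duality : SatisfiesDuality U d

/-- `A ∈ VdB(d)` with dualizing bimodule `U`, the class being described by
`Ext^•_{A^e}(A, A^e)`. -/
structure InVdBExt (U : BimodCat k A A) (d : ℤ) : Prop where
  resolution : HasFGProjectiveResolution k A
  invertible : IsInvertible U
  ext : SatisfiesExt U d

end Duality

/-! ### Localizations -/

section Localization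

variable {k : Type w} [Field k] {A B : Type u} [Ring A] [Algebra k A] [Ring B] [Algebra k B]

/-- The functor `B ⊗_A -` on (`k`-symmetric) left `A`-modules is exact. -/
def TensorLeftExact (φ : A →ₐ[k] B) : Prop :=
  ∀ (M₁ M₂ M₃ : Type u)
    [AddCommGroup M₁] [Module k M₁] [Module A M₁] [IsScalarTower k A M₁]
    [AddCommGroup M₂] [Module k M₂] [Module A M₂] [IsScalarTower k A M₂]
    [AddCommGroup M₃] [Module k M₃] [Module A M₃] [IsScalarTower k A M₃]
    (f : M₁ →ₗ[A] M₂) (g : M₂ →ₗ[A] M₃), Function.Exact f g →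
    Function.Exact
      (BalTensor.map (k := k) (ρ := fun a : A => LinearMap.mulRight k (φ a))
        (ρ' := fun a : A => LinearMap.mulRight k (φ a))
        (σ := fun a : A => Algebra.lsmul k k M₁ a) (σ' := fun a : A => Algebra.lsmul k k M₂ a)
        LinearMap.id (f.restrictScalars k) (fun _ _ => rfl) (fun a m => f.map_smul a m))
      (BalTensor.map (k := k) (ρ := fun a : A => LinearMap.mulRight k (φ a))
        (ρ' := fun a : A => LinearMap.mulRight k (φ a))
        (σ := fun a : A => Algebra.lsmul k k M₂ a) (σ' := fun a : A => Algebra.lsmul k k M₃ a)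
        LinearMap.id (g.restrictScalars k) (fun _ _ => rfl) (fun a m => g.map_smul a m))

/-- The functor `- ⊗_A B` on (`k`-symmetric) right `A`-modules is exact. -/
def TensorRightExact (φ : A →ₐ[k] B) : Prop :=
  ∀ (M₁ M₂ M₃ : Type u)
    [AddCommGroup M₁] [Module k M₁] [Module Aᵐᵒᵖ M₁] [IsScalarTower k Aᵐᵒᵖ M₁]
    [AddCommGroup M₂] [Module k M₂] [Module Aᵐᵒᵖ M₂] [IsScalarTower k Aᵐᵒᵖ M₂]
    [AddCommGroup M₃] [Module k M₃] [Module Aᵐᵒᵖ M₃] [IsScalarTower k Aᵐᵒᵖ M₃]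
    (f : M₁ →ₗ[Aᵐᵒᵖ] M₂) (g : M₂ →ₗ[Aᵐᵒᵖ] M₃), Function.Exact f g →
    Function.Exact
      (BalTensor.map (k := k) (ρ := fun a : A => Algebra.lsmul k k M₁ (op a))
        (ρ' := fun a : A => Algebra.lsmul k k M₂ (op a))
        (σ := fun a : A => LinearMap.mulLeft k (φ a)) (σ' := fun a : A => LinearMap.mulLeft k (φ a))
        (f.restrictScalars k) LinearMap.id (fun a m => f.map_smul (op a) m) (fun _ _ => rfl))
      (BalTensor.map (k := k) (ρ := fun a : A => Algebra.lsmul k k M₂ (op a))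
        (ρ' := fun a : A => Algebra.lsmul k k M₃ (op a))
        (σ := fun a : A => LinearMap.mulLeft k (φ a)) (σ' := fun a : A => LinearMap.mulLeft k (φ a))
        (g.restrictScalars k) LinearMap.id (fun a m => g.map_smul (op a) m) (fun _ _ => rfl))

/-- The canonical map `B ⊗_A B → B` induced by multiplication. -/
def mulMap (φ : A →ₐ[k] B) :
    BalTensor (fun a : A => LinearMap.mulRight k (φ a)) (fun a : A => LinearMap.mulLeft k (φ a))
      →ₗ[k] B :=
  BalTensor.lift (LinearMap.mul' k B) (fun a b c => by simp [mul_assoc])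

/-- `B` as an `A`-bimodule. -/
def bimodAA (φ : A →ₐ[k] B) : BimodCat k A A := restrict φ φ (regular k B)

/-- `B` as a `B`-`A`-bimodule. -/
def bimodBA (φ : A →ₐ[k] B) : BimodCat k B A := restrict (AlgHom.id k B) φ (regular k B)

/-- `B` as an `A`-`B`-bimodule. -/
def bimodAB (φ : A →ₐ[k] B) : BimodCat k A B := restrict φ (AlgHom.id k B) (regular k B)

/-- The `B`-bimodule `B ⊗_A U ⊗_A B`. -/
def induced (φ : A →ₐ[k] B) (U : BimodCat k A A) : BimodCat k B B :=
  tensor (tensor (bimodBA φ) U) (bimodAB φ)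

end Localization

end VdB

end

/-!
Restriction of bimodules along `φ : A → B` has the left adjoint `F X = B ⊗_A X ⊗_A B`
(`indFunctor`, `indAdj`), and the theorem is a consequence of three properties of `F`.

* Since `B ⊗_A -` and `- ⊗_A B` are exact, so is `F` (`preservesFiniteLimits_indFunctor`). As a left
  adjoint of an exact functor it preserves projective objects, it preserves finite generation, and
  `F(A^e) = B^e`.
* Since `B ⊗_A B = B`, one has `F(M) = M` for every `B`-bimodule `M`, so that restriction is fully
  faithful (`isIso_indCounit`, `resFullyFaithful`), and `F(A) = B` (`indRegular`).
* Since `B ⊗_A U ≅ U ⊗_A B`, one has `F(U) ⊗_B M ≅ U ⊗_A M` naturally in the `B`-bimodule `M`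
  (`inducedTensorFunctorIso`).

A resolution of `A` by finitely generated projective bimodules is thus carried by `F` to one of `B`.
Moreover `H^n(A, M) ≅ H^n(B, M)` and `H_n(A, M) ≅ H_n(B, M)` for `B`-bimodules `M`
(`cohomologyIso`, `homologyIso`): the former because `Ext` is compatible with adjunctions whose left
adjoint is exact and preserves projective objects, the latter because
`X ⊗_{A^e} M ≅ F(X) ⊗_{B^e} M`. The duality for `A` with coefficients in `M` is therefore the duality
for `B`.

For the form of the definition in terms of `Ext`, one compares `F(Ext^n_{A^e}(X, A^e))` with
`Ext^n_{B^e}(F(X), B^e)`. The comparison map is an isomorphism for `n = 0` and `X = A^e`, hence for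
`n = 0` and `X` finitely generated projective, and dimension shifting along a resolution of `X` by
finitely generated projective bimodules gives all `n` and `X` (`isIso_extComparison`).

If `Q` is inverse to `U`, then `Q` commutes with `B` because `U` does (`invertible_commutes`), and
`F(U) ⊗_B F(Q) ≅ U ⊗_A F(Q) ≅ U ⊗_A Q ⊗_A B ≅ B`, first as `A`-bimodules and then, restriction being
fully faithful, as `B`-bimodules. This shows that `F(U)` is invertible.
-/

noncomputable section

namespace VdB

/-! ### Bimodules through their left and right actions -/

section Actions

variable {k : Type w} [Field k] {A B C D A' B' : Type u}
  [Ring A] [Algebra k A] [Ring B] [Algebra k B] [Ring C] [Algebra k C] [Ring D] [Algebra k D]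
  [Ring A'] [Algebra k A'] [Ring B'] [Algebra k B']

lemma tmul_smul_eq (X : BimodCat k A B) (a : A) (b : Bᵐᵒᵖ) (x : X) :
    (a ⊗ₜ[k] b) • x = leftAct X a (rightAct X b.unop x) := by
  change _ = (a ⊗ₜ[k] (1 : Bᵐᵒᵖ)) • ((1 : A) ⊗ₜ[k] b) • x
  rw [smul_smul, Algebra.TensorProduct.tmul_mul_tmul, one_mul, mul_one]

lemma smul_eq_leftAct (X : BimodCat k A B) (c : k) (x : X) :
    c • x = leftAct X (algebraMap k A c) x := rfl

lemma smul_eq_rightAct (X : BimodCat k A B) (c : k) (x : X) :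
    c • x = rightAct X (algebraMap k B c) x := by
  change (algebraMap k (A ⊗[k] Bᵐᵒᵖ) c) • x = ((1 : A) ⊗ₜ[k] (algebraMap k Bᵐᵒᵖ c)) • x
  rw [Algebra.TensorProduct.algebraMap_apply, Algebra.algebraMap_eq_smul_one,
    Algebra.algebraMap_eq_smul_one, smul_tmul]

@[simp] lemma leftAct_one (X : BimodCat k A B) (x : X) : leftAct X 1 x = x := by
  change ((1 : A) ⊗ₜ[k] (1 : Bᵐᵒᵖ)) • x = x
  rw [← Algebra.TensorProduct.one_def, one_smul]

@[simp] lemma rightAct_one (X : BimodCat k A B) (x : X) : rightAct X 1 x = x := by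
  change ((1 : A) ⊗ₜ[k] (1 : Bᵐᵒᵖ)) • x = x
  rw [← Algebra.TensorProduct.one_def, one_smul]

lemma leftAct_mul (X : BimodCat k A B) (a a' : A) (x : X) :
    leftAct X (a * a') x = leftAct X a (leftAct X a' x) := by
  change _ = (a ⊗ₜ[k] (1 : Bᵐᵒᵖ)) • (a' ⊗ₜ[k] (1 : Bᵐᵒᵖ)) • x
  rw [smul_smul, Algebra.TensorProduct.tmul_mul_tmul, one_mul]
  rfl

lemma rightAct_mul (X : BimodCat k A B) (b b' : B) (x : X) :
    rightAct X (b * b') x = rightAct X b' (rightAct X b x) := by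
  change _ = ((1 : A) ⊗ₜ[k] op b') • ((1 : A) ⊗ₜ[k] op b) • x
  rw [smul_smul, Algebra.TensorProduct.tmul_mul_tmul, one_mul]
  rfl

lemma leftAct_add (X : BimodCat k A B) (a a' : A) (x : X) :
    leftAct X (a + a') x = leftAct X a x + leftAct X a' x := by
  change ((a + a') ⊗ₜ[k] (1 : Bᵐᵒᵖ)) • x = (a ⊗ₜ[k] (1 : Bᵐᵒᵖ)) • x + (a' ⊗ₜ[k] (1 : Bᵐᵒᵖ)) • x
  rw [add_tmul, add_smul]

lemma rightAct_add (X : BimodCat k A B) (b b' : B) (x : X) :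
    rightAct X (b + b') x = rightAct X b x + rightAct X b' x := by
  change ((1 : A) ⊗ₜ[k] (op b + op b')) • x = ((1 : A) ⊗ₜ[k] op b) • x + ((1 : A) ⊗ₜ[k] op b') • x
  rw [tmul_add, add_smul]

/-- An additive map commuting with both actions is `A ⊗ Bᵒᵖ`-linear, hence a map of bimodules. -/
def mkHom {X Y : BimodCat k A B} (f : X →+ Y) (hl : ∀ a x, f (leftAct X a x) = leftAct Y a (f x))
    (hr : ∀ b x, f (rightAct X b x) = rightAct Y b (f x)) : X ⟶ Y :=
  ModuleCat.ofHom
    { toFun := f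
      map_add' := f.map_add
      map_smul' := fun r x => by
        induction r using TensorProduct.induction_on with
        | zero =>
          exact (congrArg f (zero_smul (A ⊗[k] Bᵐᵒᵖ) x)).trans
            ((map_zero f).trans (zero_smul (A ⊗[k] Bᵐᵒᵖ) (f x)).symm)
        | add r s hr hs => simp only [add_smul, map_add, hr, hs]
        | tmul a b => rw [tmul_smul_eq, hl, hr, RingHom.id_apply, tmul_smul_eq] }

lemma hom_leftAct {X Y : BimodCat k A B} (f : X ⟶ Y) (a : A) (x : X) :
    f.hom (leftAct X a x) = leftAct Y a (f.hom x) := f.hom.map_smul _ x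

lemma hom_rightAct {X Y : BimodCat k A B} (f : X ⟶ Y) (b : B) (x : X) :
    f.hom (rightAct X b x) = rightAct Y b (f.hom x) := f.hom.map_smul _ x

/-- A bimodule isomorphism from a bimodule map with an additive inverse. -/
def mkIso {X Y : BimodCat k A B} (f : X ⟶ Y) (g : Y →+ X)
    (h₁ : g.comp f.hom.toAddMonoidHom = AddMonoidHom.id X)
    (h₂ : f.hom.toAddMonoidHom.comp g = AddMonoidHom.id Y) : X ≅ Y :=
  (LinearEquiv.ofBijective f.hom
    ⟨Function.LeftInverse.injective (DFunLike.congr_fun h₁),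
      Function.RightInverse.surjective (DFunLike.congr_fun h₂)⟩).toModuleIso

/-! #### Restriction -/

/-- Restriction of bimodules along two algebra maps, as a functor. -/
abbrev restrictFunctor (φ : A' →ₐ[k] A) (ψ : B' →ₐ[k] B) : BimodCat k A B ⥤ BimodCat k A' B' :=
  ModuleCat.restrictScalars (Algebra.TensorProduct.map φ (AlgHom.op ψ)).toRingHom

/-- The identity map from a bimodule to its restriction. -/
def res (φ : A' →ₐ[k] A) (ψ : B' →ₐ[k] B) (X : BimodCat k A B) : X ≃+ restrict φ ψ X :=
  AddEquiv.refl X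

@[simp] lemma leftAct_res (φ : A' →ₐ[k] A) (ψ : B' →ₐ[k] B) (X : BimodCat k A B) (a : A') (x : X) :
    leftAct (restrict φ ψ X) a (res φ ψ X x) = res φ ψ X (leftAct X (φ a) x) := by
  change (Algebra.TensorProduct.map φ (AlgHom.op ψ) (a ⊗ₜ 1)) • x = (φ a ⊗ₜ[k] (1 : Bᵐᵒᵖ)) • x
  rw [Algebra.TensorProduct.map_tmul, map_one]

@[simp] lemma rightAct_res (φ : A' →ₐ[k] A) (ψ : B' →ₐ[k] B) (X : BimodCat k A B) (b : B') (x : X) :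
    rightAct (restrict φ ψ X) b (res φ ψ X x) = res φ ψ X (rightAct X (ψ b) x) := by
  change (Algebra.TensorProduct.map φ (AlgHom.op ψ) (1 ⊗ₜ op b)) • x = ((1 : A) ⊗ₜ[k] op (ψ b)) • x
  rw [Algebra.TensorProduct.map_tmul, map_one]
  rfl

@[simp] lemma res_symm_leftAct (φ : A' →ₐ[k] A) (ψ : B' →ₐ[k] B) (X : BimodCat k A B) (a : A')
    (x : restrict φ ψ X) :
    (res φ ψ X).symm (leftAct (restrict φ ψ X) a x) = leftAct X (φ a) ((res φ ψ X).symm x) := by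
  rw [AddEquiv.symm_apply_eq, ← leftAct_res, AddEquiv.apply_symm_apply]

@[simp] lemma res_symm_rightAct (φ : A' →ₐ[k] A) (ψ : B' →ₐ[k] B) (X : BimodCat k A B) (b : B')
    (x : restrict φ ψ X) :
    (res φ ψ X).symm (rightAct (restrict φ ψ X) b x) = rightAct X (ψ b) ((res φ ψ X).symm x) := by
  rw [AddEquiv.symm_apply_eq, ← rightAct_res, AddEquiv.apply_symm_apply]

variable (k A) in
/-- The identity map from an algebra to the regular bimodule. -/
def reg : A ≃+ regular k A := AddEquiv.refl A

@[simp] lemma leftAct_reg (a x : A) : leftAct (regular k A) a (reg k A x) = reg k A (a * x) := by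
  let : Module (A ⊗[k] Aᵐᵒᵖ) A := TensorProduct.Algebra.module
  change (a ⊗ₜ[k] (1 : Aᵐᵒᵖ)) • x = a * x
  rw [TensorProduct.Algebra.smul_def]
  simp

@[simp] lemma rightAct_reg (a x : A) : rightAct (regular k A) a (reg k A x) = reg k A (x * a) := by
  let : Module (A ⊗[k] Aᵐᵒᵖ) A := TensorProduct.Algebra.module
  change ((1 : A) ⊗ₜ[k] op a) • x = x * a
  rw [TensorProduct.Algebra.smul_def]
  simp

@[simp] lemma reg_symm_leftAct (a : A) (x : regular k A) :
    (reg k A).symm (leftAct (regular k A) a x) = a * (reg k A).symm x := by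
  rw [AddEquiv.symm_apply_eq, ← leftAct_reg, AddEquiv.apply_symm_apply]

@[simp] lemma reg_symm_rightAct (a : A) (x : regular k A) :
    (reg k A).symm (rightAct (regular k A) a x) = (reg k A).symm x * a := by
  rw [AddEquiv.symm_apply_eq, ← rightAct_reg, AddEquiv.apply_symm_apply]

/-- The identity map from an algebra `A` to the regular bimodule with restricted actions. -/
def resReg (φ : A' →ₐ[k] A) (ψ : B' →ₐ[k] A) : A ≃+ restrict φ ψ (regular k A) :=
  (reg k A).trans (res φ ψ (regular k A))

@[simp] lemma leftAct_resReg (φ : A' →ₐ[k] A) (ψ : B' →ₐ[k] A) (a : A') (x : A) :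
    leftAct (restrict φ ψ (regular k A)) a (resReg φ ψ x) = resReg φ ψ (φ a * x) := by
  simp [resReg]

@[simp] lemma rightAct_resReg (φ : A' →ₐ[k] A) (ψ : B' →ₐ[k] A) (b : B') (x : A) :
    rightAct (restrict φ ψ (regular k A)) b (resReg φ ψ x) = resReg φ ψ (x * ψ b) := by
  simp [resReg]

@[simp] lemma resReg_symm_leftAct (φ : A' →ₐ[k] A) (ψ : B' →ₐ[k] A) (a : A')
    (x : restrict φ ψ (regular k A)) : (resReg φ ψ).symm (leftAct (restrict φ ψ (regular k A)) a x)
      = φ a * (resReg φ ψ).symm x := by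
  simp [resReg]

@[simp] lemma resReg_symm_rightAct (φ : A' →ₐ[k] A) (ψ : B' →ₐ[k] A) (b : B')
    (x : restrict φ ψ (regular k A)) : (resReg φ ψ).symm (rightAct (restrict φ ψ (regular k A)) b x)
      = (resReg φ ψ).symm x * ψ b := by
  simp [resReg]

/-! #### Pure tensors -/

/-- The element `x ⊗ y` of the bimodule `X ⊗_B Y`. -/
def tm {X : BimodCat k A B} {Y : BimodCat k B C} (x : X) (y : Y) : tensor X Y :=
  BalTensor.mk (rightAct X) (leftAct Y) (x ⊗ₜ y)

section tm

variable {X : BimodCat k A B} {Y : BimodCat k B C}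

lemma tm_add (x : X) (y y' : Y) : tm x (y + y') = tm x y + tm x y' := by
  unfold tm
  rw [tmul_add, map_add]
  rfl

lemma add_tm (x x' : X) (y : Y) : tm (x + x') y = tm x y + tm x' y := by
  unfold tm
  rw [add_tmul, map_add]
  rfl

lemma tm_balanced (b : B) (x : X) (y : Y) : tm (rightAct X b x) y = tm x (leftAct Y b y) :=
  BalTensor.mk_rel b x y

@[simp] lemma leftAct_tm (a : A) (x : X) (y : Y) :
    leftAct (tensor X Y) a (tm x y) = tm (leftAct X a x) y := by
  refine (tensorAct_tmul X Y a 1 x y).trans ?_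
  rw [unop_one, rightAct_one]
  rfl

@[simp] lemma rightAct_tm (c : C) (x : X) (y : Y) :
    rightAct (tensor X Y) c (tm x y) = tm x (rightAct Y c y) := by
  refine (tensorAct_tmul X Y 1 (op c) x y).trans ?_
  rw [leftAct_one]
  rfl

@[elab_as_elim]
lemma tm_induction {p : tensor X Y → Prop} (t : tensor X Y) (zero : p 0)
    (tm : ∀ x y, p (tm x y)) (add : ∀ s t, p s → p t → p (s + t)) : p t := by
  obtain ⟨t, rfl⟩ := BalTensor.mk_surjective (ρ := rightAct X) (σ := leftAct Y) t
  induction t using TensorProduct.induction_on with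
  | zero => rw [map_zero]; exact zero
  | tmul x y => exact tm x y
  | add s t hs ht => rw [map_add]; exact add _ _ hs ht

end tm

/-- An additive map out of a balanced tensor product, from a biadditive map which is balanced
over `k` and over the index type. -/
def BalTensor.liftAdd {ι : Type*} {N M : Type u} {P : Type*} [AddCommGroup N] [Module k N]
    [AddCommGroup M] [Module k M] [AddCommGroup P] {ρ : ι → Module.End k N} {σ : ι → Module.End k M}
    (f : N →+ M →+ P) (hk : ∀ (c : k) n m, f (c • n) m = f n (c • m))
    (hf : ∀ i n m, f (ρ i n) m = f n (σ i m)) : BalTensor ρ σ →+ P :=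
  QuotientAddGroup.lift (balRel ρ σ).toAddSubgroup (TensorProduct.liftAddHom f hk) (by
    intro t ht
    change t ∈ Submodule.span k _ at ht
    rw [AddMonoidHom.mem_ker]
    induction ht using Submodule.closure_induction with
    | zero => exact map_zero _
    | add s t _ _ hs ht => rw [map_add, hs, ht, add_zero]
    | smul_mem c s hs =>
      obtain ⟨i, n, m, rfl⟩ := hs
      rw [smul_sub, smul_tmul', smul_tmul', map_sub, ← map_smul]
      exact sub_eq_zero.2 (hf i (c • n) m))

/-- Biadditive functions as additive maps. -/
def biadd {N M P : Type*} [AddCommGroup N] [AddCommGroup M] [AddCommGroup P] (f : N → M → P)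
    (h₁ : ∀ n n' m, f (n + n') m = f n m + f n' m) (h₂ : ∀ n m m', f n (m + m') = f n m + f n m') :
    N →+ M →+ P :=
  AddMonoidHom.mk' (fun n => AddMonoidHom.mk' (f n) (h₂ n)) (fun n n' => by
    ext m
    exact h₁ n n' m)

/-- The additive map `x ⊗ y ↦ f x y` out of `X ⊗_B Y` induced by a balanced biadditive `f`. -/
def tlift {X : BimodCat k A B} {Y : BimodCat k B C} {P : Type*} [AddCommGroup P] (f : X → Y → P)
    (h₁ : ∀ x x' y, f (x + x') y = f x y + f x' y) (h₂ : ∀ x y y', f x (y + y') = f x y + f x y')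
    (h : ∀ b x y, f (rightAct X b x) y = f x (leftAct Y b y)) : tensor X Y →+ P :=
  BalTensor.liftAdd (ρ := rightAct X) (σ := leftAct Y) (biadd f h₁ h₂)
    (fun c x y => by
      rw [smul_eq_rightAct, smul_eq_leftAct]
      exact h _ x y) h

@[simp] lemma tlift_tm {X : BimodCat k A B} {Y : BimodCat k B C} {P : Type*} [AddCommGroup P]
    (f : X → Y → P) (h₁) (h₂) (h) (x : X) (y : Y) : tlift f h₁ h₂ h (tm x y) = f x y := rfl

lemma tensor_addHom_ext {X : BimodCat k A B} {Y : BimodCat k B C} {P : Type*} [AddCommGroup P]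
    {f g : tensor X Y →+ P} (h : ∀ x y, f (tm x y) = g (tm x y)) : f = g := by
  ext t
  induction t using tm_induction with
  | zero => simp
  | tm x y => exact h x y
  | add s t hs ht => rw [map_add, map_add, hs, ht]

/-- The pure tensor as a biadditive map. -/
def tmHom (X : BimodCat k A B) (Y : BimodCat k B C) : X →+ Y →+ tensor X Y :=
  biadd tm add_tm tm_add

@[simp] lemma tmHom_apply (X : BimodCat k A B) (Y : BimodCat k B C) (x : X) (y : Y) :
    tmHom X Y x y = tm x y := rfl

lemma tensor_hom_ext {X : BimodCat k A B} {Y : BimodCat k B C} {Z : BimodCat k A C}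
    {f g : tensor X Y ⟶ Z} (h : ∀ x y, f.hom (tm x y) = g.hom (tm x y)) : f = g := by
  apply ModuleCat.hom_ext
  ext t
  exact DFunLike.congr_fun (tensor_addHom_ext (f := f.hom.toAddMonoidHom)
    (g := g.hom.toAddMonoidHom) h) t

/-- A bimodule map out of `X ⊗_B Y`, from a balanced biadditive map compatible with the outer
actions. -/
def tliftHom {X : BimodCat k A B} {Y : BimodCat k B C} {Z : BimodCat k A C} (f : X → Y → Z)
    (h₁ : ∀ x x' y, f (x + x') y = f x y + f x' y) (h₂ : ∀ x y y', f x (y + y') = f x y + f x y')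
    (h : ∀ b x y, f (rightAct X b x) y = f x (leftAct Y b y))
    (hl : ∀ a x y, f (leftAct X a x) y = leftAct Z a (f x y))
    (hr : ∀ c x y, f x (rightAct Y c y) = rightAct Z c (f x y)) : tensor X Y ⟶ Z :=
  mkHom (tlift f h₁ h₂ h)
    (fun a t => by
      induction t using tm_induction with
      | zero => simp
      | tm x y => simp [hl]
      | add s t hs ht => simp only [map_add, hs, ht])
    (fun a t => by
      induction t using tm_induction with
      | zero => simp
      | tm x y => simp [hr]
      | add s t hs ht => simp only [map_add, hs, ht])

@[simp] lemma tliftHom_tm {X : BimodCat k A B} {Y : BimodCat k B C} {Z : BimodCat k A C}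
    (f : X → Y → Z) (h₁) (h₂) (h) (hl) (hr) (x : X) (y : Y) :
    (tliftHom f h₁ h₂ h hl hr).hom (tm x y) = f x y := rfl

/-- The map `f ⊗ id : X ⊗_B Y → X' ⊗_B Y` of bimodules. -/
def tensorMapLeft {X X' : BimodCat k A B} (f : X ⟶ X') (Y : BimodCat k B C) :
    tensor X Y ⟶ tensor X' Y :=
  tliftHom (fun x y => tm (f.hom x) y) (fun _ _ _ => by rw [map_add, add_tm])
    (fun _ _ _ => tm_add _ _ _) (fun b x y => by rw [hom_rightAct, tm_balanced])
    (fun a x y => by rw [hom_leftAct, leftAct_tm]) (fun c x y => by rw [rightAct_tm])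

section Triple

variable {X : BimodCat k A B} {Y : BimodCat k B C} {Z : BimodCat k C D} {P : Type*}
  [AddCommGroup P]

lemma triple_addHom_ext {f g : tensor (tensor X Y) Z →+ P}
    (h : ∀ x y z, f (tm (tm x y) z) = g (tm (tm x y) z)) : f = g :=
  tensor_addHom_ext fun t z => DFunLike.congr_fun (tensor_addHom_ext (X := X) (Y := Y)
    (f := f.comp ((tmHom (tensor X Y) Z).flip z)) (g := g.comp ((tmHom (tensor X Y) Z).flip z))
    fun x y => h x y z) t

lemma triple_addHom_ext' {f g : tensor X (tensor Y Z) →+ P}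
    (h : ∀ x y z, f (tm x (tm y z)) = g (tm x (tm y z))) : f = g :=
  tensor_addHom_ext fun x t => DFunLike.congr_fun (tensor_addHom_ext (X := Y) (Y := Z)
    (f := f.comp (tmHom X (tensor Y Z) x)) (g := g.comp (tmHom X (tensor Y Z) x))
    fun y z => h x y z) t

lemma triple_hom_ext {W : BimodCat k A D} {f g : tensor (tensor X Y) Z ⟶ W}
    (h : ∀ x y z, f.hom (tm (tm x y) z) = g.hom (tm (tm x y) z)) : f = g :=
  tensor_hom_ext (DFunLike.congr_fun (triple_addHom_ext (f := f.hom.toAddMonoidHom)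
    (g := g.hom.toAddMonoidHom) h) <| tm · ·)

/-- The additive map `(x ⊗ y) ⊗ z ↦ f x y z` induced by a balanced triadditive map `f`. -/
def tlift₃ (f : X → Y → Z → P)
    (h₁ : ∀ x x' y z, f (x + x') y z = f x y z + f x' y z)
    (h₂ : ∀ x y y' z, f x (y + y') z = f x y z + f x y' z)
    (h₃ : ∀ x y z z', f x y (z + z') = f x y z + f x y z')
    (hb : ∀ b x y z, f (rightAct X b x) y z = f x (leftAct Y b y) z)
    (hc : ∀ c x y z, f x (rightAct Y c y) z = f x y (leftAct Z c z)) :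
    tensor (tensor X Y) Z →+ P :=
  let g (z : Z) : tensor X Y →+ P :=
    tlift (fun x y => f x y z) (fun _ _ _ => h₁ _ _ _ _) (fun _ _ _ => h₂ _ _ _ _)
      (fun _ _ _ => hb _ _ _ _)
  tlift (fun t z => g z t) (fun _ _ z => map_add (g z) _ _)
    (fun t z z' => DFunLike.congr_fun (f := g (z + z')) (g := g z + g z')
      (tensor_addHom_ext fun x y => h₃ x y z z') t)
    (fun c t z => DFunLike.congr_fun
      (f := (g z).comp (rightAct (tensor X Y) c).toAddMonoidHom) (g := g (leftAct Z c z))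
      (tensor_addHom_ext fun x y => by
        refine (congrArg (g z) (rightAct_tm c x y)).trans (hc c x y z)) t)

@[simp] lemma tlift₃_tm (f : X → Y → Z → P) (h₁) (h₂) (h₃) (hb) (hc) (x : X) (y : Y) (z : Z) :
    tlift₃ f h₁ h₂ h₃ hb hc (tm (tm x y) z) = f x y z := rfl

/-- The additive map `x ⊗ (y ⊗ z) ↦ f x y z` induced by a balanced triadditive map `f`. -/
def tlift₃' (f : X → Y → Z → P)
    (h₁ : ∀ x x' y z, f (x + x') y z = f x y z + f x' y z)
    (h₂ : ∀ x y y' z, f x (y + y') z = f x y z + f x y' z)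
    (h₃ : ∀ x y z z', f x y (z + z') = f x y z + f x y z')
    (hb : ∀ b x y z, f (rightAct X b x) y z = f x (leftAct Y b y) z)
    (hc : ∀ c x y z, f x (rightAct Y c y) z = f x y (leftAct Z c z)) :
    tensor X (tensor Y Z) →+ P :=
  let g (x : X) : tensor Y Z →+ P :=
    tlift (fun y z => f x y z) (fun _ _ _ => h₂ _ _ _ _) (fun _ _ _ => h₃ _ _ _ _)
      (fun _ _ _ => hc _ _ _ _)
  tlift (fun x t => g x t)
    (fun x x' t => DFunLike.congr_fun (f := g (x + x')) (g := g x + g x')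
      (tensor_addHom_ext fun y z => h₁ x x' y z) t)
    (fun x _ _ => map_add (g x) _ _)
    (fun b x t => DFunLike.congr_fun
      (f := g (rightAct X b x)) (g := (g x).comp (leftAct (tensor Y Z) b).toAddMonoidHom)
      (tensor_addHom_ext fun y z => by
        refine (hb b x y z).trans (congrArg (g x) (leftAct_tm b y z)).symm) t)

@[simp] lemma tlift₃'_tm (f : X → Y → Z → P) (h₁) (h₂) (h₃) (hb) (hc) (x : X) (y : Y) (z : Z) :
    tlift₃' f h₁ h₂ h₃ hb hc (tm x (tm y z)) = f x y z := rfl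

/-- The bimodule map `(x ⊗ y) ⊗ z ↦ f x y z` induced by a balanced triadditive map `f` compatible
with the outer actions. -/
def tlift₃Hom {W : BimodCat k A D} (f : X → Y → Z → W)
    (h₁ : ∀ x x' y z, f (x + x') y z = f x y z + f x' y z)
    (h₂ : ∀ x y y' z, f x (y + y') z = f x y z + f x y' z)
    (h₃ : ∀ x y z z', f x y (z + z') = f x y z + f x y z')
    (hb : ∀ b x y z, f (rightAct X b x) y z = f x (leftAct Y b y) z)
    (hc : ∀ c x y z, f x (rightAct Y c y) z = f x y (leftAct Z c z))
    (hl : ∀ a x y z, f (leftAct X a x) y z = leftAct W a (f x y z))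
    (hr : ∀ d x y z, f x y (rightAct Z d z) = rightAct W d (f x y z)) :
    tensor (tensor X Y) Z ⟶ W :=
  mkHom (tlift₃ f h₁ h₂ h₃ hb hc)
    (fun a => DFunLike.congr_fun (f := (tlift₃ f h₁ h₂ h₃ hb hc).comp
        (leftAct (tensor (tensor X Y) Z) a).toAddMonoidHom)
      (g := (leftAct W a).toAddMonoidHom.comp (tlift₃ f h₁ h₂ h₃ hb hc))
      (triple_addHom_ext fun x y z => by simp [hl]))
    (fun d => DFunLike.congr_fun (f := (tlift₃ f h₁ h₂ h₃ hb hc).comp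
        (rightAct (tensor (tensor X Y) Z) d).toAddMonoidHom)
      (g := (rightAct W d).toAddMonoidHom.comp (tlift₃ f h₁ h₂ h₃ hb hc))
      (triple_addHom_ext fun x y z => by simp [hr]))

@[simp] lemma tlift₃Hom_tm {W : BimodCat k A D} (f : X → Y → Z → W) (h₁) (h₂) (h₃) (hb) (hc) (hl)
    (hr) (x : X) (y : Y) (z : Z) :
    (tlift₃Hom f h₁ h₂ h₃ hb hc hl hr).hom (tm (tm x y) z) = f x y z := rfl

end Triple

/-- The functor `- ⊗_B Y`. -/
def tensorRightFunctor (A : Type u) [Ring A] [Algebra k A] (Y : BimodCat k B C) :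
    BimodCat k A B ⥤ BimodCat k A C where
  obj X := tensor X Y
  map f := tensorMapLeft f Y
  map_id _ := tensor_hom_ext fun _ _ => rfl
  map_comp _ _ := tensor_hom_ext fun _ _ => rfl

end Actions

/-! ### Tensoring with the localization -/

section Loc

variable {k : Type w} [Field k] {A B C D A' B' C' D' : Type u}
  [Ring A] [Algebra k A] [Ring B] [Algebra k B] [Ring C] [Algebra k C] [Ring D] [Algebra k D]
  [Ring A'] [Algebra k A'] [Ring B'] [Algebra k B'] [Ring C'] [Algebra k C'] [Ring D']
  [Algebra k D']

/-- When `B ⊗_A B → B` is injective, a balanced biadditive map on `B × B` only depends on the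
product of its arguments. -/
lemma balanced_eq {φ : A →ₐ[k] B} (hmul : Function.Injective (mulMap φ)) {Z : Type*}
    [AddCommGroup Z] (g : B → B → Z) (h₁ : ∀ x x' y, g (x + x') y = g x y + g x' y)
    (h₂ : ∀ x y y', g x (y + y') = g x y + g x y')
    (h : ∀ a x y, g (x * φ a) y = g x (φ a * y)) {x y x' y' : B} (e : x * y = x' * y') :
    g x y = g x' y' := by
  let L := BalTensor.liftAdd (k := k) (ρ := fun a : A => LinearMap.mulRight k (φ a))
    (σ := fun a : A => LinearMap.mulLeft k (φ a)) (biadd g h₁ h₂)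
    (fun c x y => by
      have := h (algebraMap k A c) x y
      rw [AlgHom.commutes, ← Algebra.commutes, ← Algebra.smul_def, ← Algebra.smul_def] at this
      exact this) h
  refine congrArg L (hmul (a₁ := BalTensor.mk _ _ (x ⊗ₜ y)) (a₂ := BalTensor.mk _ _ (x' ⊗ₜ y')) ?_)
  exact e

variable (φ : A →ₐ[k] B)

/-- The multiplication `B ⊗_A M → M` for a left `B`-module `M`, `b ⊗ m ↦ b m`. -/
def mulLeftHom (σ : B' →ₐ[k] B) (ψ : C' →ₐ[k] C) (M : BimodCat k B C) :
    tensor (restrict σ φ (regular k B)) (restrict φ ψ M) ⟶ restrict σ ψ M :=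
  tliftHom (fun b m => res σ ψ M (leftAct M ((resReg σ φ).symm b) ((res φ ψ M).symm m)))
    (by simp [leftAct_add]) (by simp) (by simp [leftAct_mul]) (by simp [leftAct_mul])
    (by simp [leftAct_rightAct])

@[simp] lemma mulLeftHom_tm (σ : B' →ₐ[k] B) (ψ : C' →ₐ[k] C) (M : BimodCat k B C) (b) (m) :
    (mulLeftHom φ σ ψ M).hom (tm b m) =
      res σ ψ M (leftAct M ((resReg σ φ).symm b) ((res φ ψ M).symm m)) := rfl

/-- If `B ⊗_A B = B`, then `B ⊗_A M = M` for every left `B`-module `M`. -/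
def mulLeftIso (hmul : Function.Injective (mulMap φ)) (σ : B' →ₐ[k] B) (ψ : C' →ₐ[k] C)
    (M : BimodCat k B C) :
    tensor (restrict σ φ (regular k B)) (restrict φ ψ M) ≅ restrict σ ψ M :=
  mkIso (mulLeftHom φ σ ψ M)
    ((tmHom (restrict σ φ (regular k B)) (restrict φ ψ M) (resReg σ φ 1)).comp
      ((res σ ψ M).symm.trans (res φ ψ M)).toAddMonoidHom)
    (tensor_addHom_ext fun b m => by
      obtain ⟨b, rfl⟩ := (resReg σ φ).surjective b
      obtain ⟨m, rfl⟩ := (res φ ψ M).surjective m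
      have := balanced_eq hmul
        (fun x y => tm (resReg σ φ x) (res φ ψ M (leftAct M y m)))
        (by simp [add_tm]) (by simp [leftAct_add, tm_add])
        (by simp [leftAct_mul, ← tm_balanced, ← leftAct_res]) (one_mul b |>.trans (mul_one b).symm)
      simpa using this)
    (by ext m; simp)

/-! #### Associativity and units -/

/-- Associativity, `(x ⊗ y) ⊗ z ↦ x ⊗ (y ⊗ z)`. -/
def assoc (X : BimodCat k A B) (Y : BimodCat k B C) (Z : BimodCat k C D) :
    tensor (tensor X Y) Z ≅ tensor X (tensor Y Z) :=
  mkIso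
    (tlift₃Hom (fun x y z => tm x (tm y z)) (by simp [add_tm]) (by simp [add_tm, tm_add])
      (by simp [tm_add]) (by simp [tm_balanced]) (by simp [tm_balanced]) (by simp) (by simp))
    (tlift₃' (fun x y z => tm (tm x y) z) (by simp [add_tm]) (by simp [add_tm, tm_add])
      (by simp [tm_add]) (by simp [tm_balanced]) (by simp [← tm_balanced]))
    (triple_addHom_ext (by simp)) (triple_addHom_ext' (by simp))

/-- `A ⊗_A X ≅ X`. -/
def leftUnitor (X : BimodCat k A B) : tensor (regular k A) X ≅ X :=
  mkIso
    (tliftHom (fun a x => leftAct X ((reg k A).symm a) x) (by simp [leftAct_add]) (by simp)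
      (by simp [leftAct_mul]) (by simp [leftAct_mul]) (by simp [leftAct_rightAct]))
    (tmHom (regular k A) X (reg k A 1))
    (tensor_addHom_ext fun a x => by simp [← tm_balanced])
    (by ext; simp)

/-- `X ⊗_B B ≅ X`. -/
def rightUnitor (X : BimodCat k A B) : tensor X (regular k B) ≅ X :=
  mkIso
    (tliftHom (fun x b => rightAct X ((reg k B).symm b) x) (by simp) (by simp [rightAct_add])
      (by simp [rightAct_mul]) (by simp [leftAct_rightAct]) (by simp [rightAct_mul]))
    ((tmHom X (regular k B)).flip (reg k B 1))
    (tensor_addHom_ext fun a x => by simp [tm_balanced])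
    (by ext; simp)

end Loc

/-! ### Induction of bimodules along `A → B` and its adjunction with restriction -/

section Induction

variable {k : Type w} [Field k] {A B : Type u} [Ring A] [Algebra k A] [Ring B] [Algebra k B]
  (φ : A →ₐ[k] B)

/-- The identity map from `B` to `B` as a `B`-`A`-bimodule. -/
def bBA : B ≃+ bimodBA φ := resReg (AlgHom.id k B) φ

/-- The identity map from `B` to `B` as an `A`-`B`-bimodule. -/
def bAB : B ≃+ bimodAB φ := resReg φ (AlgHom.id k B)

@[simp] lemma leftAct_bBA (c b : B) : leftAct (bimodBA φ) c (bBA φ b) = bBA φ (c * b) :=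
  leftAct_resReg _ _ _ _

@[simp] lemma rightAct_bBA (a : A) (b : B) : rightAct (bimodBA φ) a (bBA φ b) = bBA φ (b * φ a) :=
  rightAct_resReg _ _ _ _

@[simp] lemma leftAct_bAB (a : A) (b : B) : leftAct (bimodAB φ) a (bAB φ b) = bAB φ (φ a * b) :=
  leftAct_resReg _ _ _ _

@[simp] lemma rightAct_bAB (c b : B) : rightAct (bimodAB φ) c (bAB φ b) = bAB φ (b * c) :=
  rightAct_resReg _ _ _ _

@[simp] lemma bBA_symm_rightAct (a : A) (b : bimodBA φ) :
    (bBA φ).symm (rightAct (bimodBA φ) a b) = (bBA φ).symm b * φ a :=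
  resReg_symm_rightAct _ _ _ _

@[simp] lemma bAB_symm_leftAct (a : A) (b : bimodAB φ) :
    (bAB φ).symm (leftAct (bimodAB φ) a b) = φ a * (bAB φ).symm b :=
  resReg_symm_leftAct _ _ _ _

/-- The element `b ⊗ x ⊗ b'` of the bimodule `B ⊗_A X ⊗_A B`. -/
def ind {X : BimodCat k A A} (b : B) (x : X) (b' : B) : induced φ X :=
  tm (tm (bBA φ b) x) (bAB φ b')

section ind

variable {X Y : BimodCat k A A}

lemma ind_add_left (b₁ b₂ : B) (x : X) (b' : B) :
    ind φ (b₁ + b₂) x b' = ind φ b₁ x b' + ind φ b₂ x b' := by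
  rw [ind, map_add, add_tm, add_tm]
  rfl

lemma ind_add_mid (b : B) (x₁ x₂ : X) (b' : B) :
    ind φ b (x₁ + x₂) b' = ind φ b x₁ b' + ind φ b x₂ b' := by
  rw [ind, tm_add, add_tm]
  rfl

lemma ind_add_right (b : B) (x : X) (b₁ b₂ : B) :
    ind φ b x (b₁ + b₂) = ind φ b x b₁ + ind φ b x b₂ := by
  rw [ind, map_add, tm_add]
  rfl

@[simp] lemma leftAct_ind (c b : B) (x : X) (b' : B) :
    leftAct (induced φ X) c (ind φ b x b') = ind φ (c * b) x b' := by
  refine (leftAct_tm _ _ _).trans ?_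
  rw [leftAct_tm, leftAct_bBA]
  rfl

@[simp] lemma rightAct_ind (c b : B) (x : X) (b' : B) :
    rightAct (induced φ X) c (ind φ b x b') = ind φ b x (b' * c) := by
  refine (rightAct_tm _ _ _).trans ?_
  rw [rightAct_bAB]
  rfl

lemma ind_leftAct (a : A) (b : B) (x : X) (b' : B) :
    ind φ b (leftAct X a x) b' = ind φ (b * φ a) x b' := by
  rw [ind, ← tm_balanced, rightAct_bBA]
  rfl

lemma ind_rightAct (a : A) (b : B) (x : X) (b' : B) :
    ind φ b (rightAct X a x) b' = ind φ b x (φ a * b') := by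
  rw [ind, ← rightAct_tm, tm_balanced, leftAct_bAB]
  rfl

lemma induced_addHom_ext {P : Type*} [AddCommGroup P] {f g : induced φ X →+ P}
    (h : ∀ b x b', f (ind φ b x b') = g (ind φ b x b')) : f = g :=
  triple_addHom_ext fun b x b' => by
    obtain ⟨b, rfl⟩ := (bBA φ).surjective b
    obtain ⟨b', rfl⟩ := (bAB φ).surjective b'
    exact h b x b'

/-- A map of `B`-bimodules out of `B ⊗_A X ⊗_A B` is determined by its values on `1 ⊗ x ⊗ 1`. -/
lemma induced_hom_ext {M : BimodCat k B B} {f g : induced φ X ⟶ M}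
    (h : ∀ x, f.hom (ind φ 1 x 1) = g.hom (ind φ 1 x 1)) : f = g := by
  refine ModuleCat.hom_ext (LinearMap.ext fun t => DFunLike.congr_fun (induced_addHom_ext φ
    (f := f.hom.toAddMonoidHom) (g := g.hom.toAddMonoidHom) fun b x b' => ?_) t)
  have e : ind φ b x b' = leftAct (induced φ X) b (rightAct (induced φ X) b' (ind φ 1 x 1)) := by
    simp
  change f.hom _ = g.hom _
  rw [e, hom_leftAct, hom_leftAct, hom_rightAct, hom_rightAct, h]

/-- The additive map `b ⊗ x ⊗ b' ↦ f b x b'` induced by a balanced triadditive map `f`. -/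
def indLift {P : Type*} [AddCommGroup P] (f : B → X → B → P)
    (h₁ : ∀ b₁ b₂ x b', f (b₁ + b₂) x b' = f b₁ x b' + f b₂ x b')
    (h₂ : ∀ b x₁ x₂ b', f b (x₁ + x₂) b' = f b x₁ b' + f b x₂ b')
    (h₃ : ∀ b x b₁ b₂, f b x (b₁ + b₂) = f b x b₁ + f b x b₂)
    (hl : ∀ a b x b', f (b * φ a) x b' = f b (leftAct X a x) b')
    (hr : ∀ a b x b', f b (rightAct X a x) b' = f b x (φ a * b')) : induced φ X →+ P :=
  tlift₃ (fun b x b' => f ((bBA φ).symm b) x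
      ((bAB φ).symm b'))
    (by simp [h₁]) (by simp [h₂]) (by simp [h₃]) (by simp [hl]) (by simp [hr])

@[simp] lemma indLift_ind {P : Type*} [AddCommGroup P] (f : B → X → B → P) (h₁) (h₂) (h₃) (hl) (hr)
    (b : B) (x : X) (b' : B) : indLift φ f h₁ h₂ h₃ hl hr (ind φ b x b') = f b x b' := rfl

end ind

/-- The functor `B ⊗_A - ⊗_A B`. -/
def indFunctor : BimodCat k A A ⥤ BimodCat k B B :=
  tensorFunctor A (bimodBA φ) ⋙ tensorRightFunctor B (bimodAB φ)

/-- The functor of restriction from `B`-bimodules to `A`-bimodules. -/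
abbrev resFunctor : BimodCat k B B ⥤ BimodCat k A A := restrictFunctor φ φ

/-- The unit `X → B ⊗_A X ⊗_A B`, `x ↦ 1 ⊗ x ⊗ 1`. -/
def indUnit (X : BimodCat k A A) : X ⟶ restrict φ φ (induced φ X) :=
  mkHom ((res φ φ (induced φ X)).toAddMonoidHom.comp
    (AddMonoidHom.mk' (fun x => ind φ 1 x 1) (fun _ _ => ind_add_mid _ _ _ _ _)))
    (by simp [ind_leftAct]) (by simp [ind_rightAct])

@[simp] lemma indUnit_apply (X : BimodCat k A A) (x : X) :
    (indUnit φ X).hom x = res φ φ (induced φ X) (ind φ 1 x 1) := rfl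

/-- The counit `B ⊗_A M ⊗_A B → M`, `b ⊗ m ⊗ b' ↦ b m b'`. -/
def indCounit (M : BimodCat k B B) : induced φ (restrict φ φ M) ⟶ M :=
  let f := indLift φ (X := restrict φ φ M)
    (fun b m b' => leftAct M b (rightAct M b' ((res φ φ M).symm m)))
    (by simp [leftAct_add]) (by simp) (by simp [rightAct_add]) (by simp [leftAct_mul,
      leftAct_rightAct]) (by simp [rightAct_mul])
  mkHom f
    (fun c => DFunLike.congr_fun (f := f.comp (leftAct (induced φ (restrict φ φ M))
      c).toAddMonoidHom) (g := (leftAct M c).toAddMonoidHom.comp f)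
      (induced_addHom_ext φ fun b m b' => by simp [f, leftAct_mul]))
    (fun c => DFunLike.congr_fun (f := f.comp (rightAct (induced φ (restrict φ φ M))
      c).toAddMonoidHom) (g := (rightAct M c).toAddMonoidHom.comp f)
      (induced_addHom_ext φ fun b m b' => by simp [f, rightAct_mul, leftAct_rightAct]))

@[simp] lemma indCounit_ind (M : BimodCat k B B) (b : B) (m : restrict φ φ M) (b' : B) :
    (indCounit φ M).hom (ind φ b m b') = leftAct M b (rightAct M b' ((res φ φ M).symm m)) := rfl

/-- Induction of bimodules is left adjoint to restriction. -/
def indAdj : indFunctor φ ⊣ resFunctor φ :=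
  Adjunction.mkOfUnitCounit
    { unit := { app := indUnit φ }
      counit :=
        { app := indCounit φ
          naturality := fun M N f => induced_hom_ext φ fun m => by
            obtain ⟨m, rfl⟩ := (res φ φ M).surjective m
            change (indCounit φ N).hom (ind φ 1 (res φ φ N (f.hom m)) 1) =
              f.hom ((indCounit φ M).hom (ind φ 1 (res φ φ M m) 1))
            simp }
      left_triangle := by
        ext X : 2
        refine induced_hom_ext φ fun x => ?_
        change (indCounit φ (induced φ X)).hom (ind φ 1 ((indUnit φ X).hom x) 1) = ind φ 1 x 1
        rw [indCounit_ind, indUnit_apply]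
        simp
      right_triangle := by
        ext M : 2
        refine ModuleCat.hom_ext (LinearMap.ext fun m => ?_)
        obtain ⟨m, rfl⟩ := (res φ φ M).surjective m
        change res φ φ M ((indCounit φ M).hom (ind φ 1 (res φ φ M m) 1)) = res φ φ M m
        simp }

/-- If `B ⊗_A B = B`, then `B ⊗_A M ⊗_A B = M` for every `B`-bimodule `M`. -/
lemma isIso_indCounit (hmul : Function.Injective (mulMap φ)) (M : BimodCat k B B) :
    IsIso (indCounit φ M) := by
  let g : M →+ induced φ (restrict φ φ M) :=
    AddMonoidHom.mk' (fun m => ind φ 1 (res φ φ M m) 1)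
      (fun x y => by rw [map_add, ind_add_mid])
  refine (mkIso (indCounit φ M) g (induced_addHom_ext φ fun b m b' => ?_)
    (by ext m; simp [g])).isIso_hom
  obtain ⟨m, rfl⟩ := (res φ φ M).surjective m
  have h₁ : ind φ 1 (res φ φ M (leftAct M b (rightAct M b' m))) 1 =
      ind φ b (res φ φ M (rightAct M b' m)) 1 := by
    have := balanced_eq hmul (fun x y => ind φ x (res φ φ M (leftAct M y (rightAct M b' m))) 1)
      (by simp [ind_add_left]) (by simp [leftAct_add, ind_add_mid])
      (by simp [leftAct_mul, ← ind_leftAct]) (one_mul b |>.trans (mul_one b).symm)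
    simpa using this
  have h₂ : ind φ b (res φ φ M (rightAct M b' m)) 1 = ind φ b (res φ φ M m) b' := by
    have := balanced_eq hmul (fun x y => ind φ b (res φ φ M (rightAct M x m)) y)
      (by simp [rightAct_add, ind_add_mid]) (by simp [ind_add_right])
      (by simp [rightAct_mul, ← ind_rightAct]) (mul_one b' |>.trans (one_mul b').symm)
    simpa using this
  exact h₁.trans h₂

/-- If `B ⊗_A B = B`, restriction from `B`-bimodules to `A`-bimodules is fully faithful. -/
def resFullyFaithful (hmul : Function.Injective (mulMap φ)) : (resFunctor φ).FullyFaithful :=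
  haveI : IsIso (indAdj φ).counit := by
    have (M : BimodCat k B B) : IsIso ((indAdj φ).counit.app M) := isIso_indCounit φ hmul M
    exact NatIso.isIso_of_isIso_app _
  (indAdj φ).fullyFaithfulROfIsIsoCounit

/-- `A → B` as a map of `A`-bimodules. -/
def regMap : regular k A ⟶ bimodAA φ :=
  mkHom (Y := restrict φ φ (regular k B)) ((res φ φ (regular k B)).toAddMonoidHom.comp
    ((reg k B).toAddMonoidHom.comp (φ.toRingHom.toAddMonoidHom.comp
    (reg k A).symm.toAddMonoidHom))) (by simp) (by simp)

/-- `B ⊗_A A ⊗_A B ≅ B`. -/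
def indRegular (hmul : Function.Injective (mulMap φ)) : induced φ (regular k A) ≅ regular k B :=
  let f : induced φ (regular k A) ⟶ regular k B :=
    (indFunctor φ).map (regMap φ) ≫ indCounit φ (regular k B)
  have hf (b : B) (a : A) (b' : B) :
      f.hom (ind φ b (reg k A a) b') = reg k B (b * (φ a * b')) := by
    change (indCounit φ (regular k B)).hom
      (ind φ b (res φ φ (regular k B) (reg k B (φ a))) b') = _
    simp
  mkIso f
    ((AddMonoidHom.mk' (fun b => ind φ 1 (reg k A 1) b) (fun _ _ => ind_add_right _ _ _ _ _)).comp
      (reg k B).symm.toAddMonoidHom)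
    (induced_addHom_ext φ fun b a b' => by
      obtain ⟨a, rfl⟩ := (reg k A).surjective a
      have h₁ : ind φ 1 (reg k A 1) (b * (φ a * b')) = ind φ b (reg k A 1) (φ a * b') :=
        balanced_eq hmul (fun x y => ind φ x (reg k A 1) y)
          (by simp [ind_add_left]) (by simp [ind_add_right])
          (by simp [← ind_rightAct, ← ind_leftAct]) (one_mul _)
      have h₂ := ind_rightAct φ a b (reg k A 1) b'
      rw [rightAct_reg, one_mul] at h₂
      change ind φ 1 (reg k A 1) ((reg k B).symm (f.hom (ind φ b (reg k A a) b'))) = _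
      rw [hf, AddEquiv.symm_apply_apply, h₁, ← h₂]
      rfl)
    (by
      ext m
      change f.hom (ind φ 1 (reg k A 1) ((reg k B).symm m)) = m
      rw [hf]
      simp)

end Induction

/-! ### Exactness and finiteness of induction -/

section Exactness

variable {k : Type w} [Field k] {A B C : Type u} [Ring A] [Algebra k A] [Ring B] [Algebra k B]
  [Ring C] [Algebra k C] (φ : A →ₐ[k] B)

instance : (indFunctor φ).Additive where
  map_add {X Y f g} := induced_hom_ext φ fun x => by
    change ind φ 1 (f.hom x + g.hom x) 1 = ind φ 1 (f.hom x) 1 + ind φ 1 (g.hom x) 1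
    rw [ind_add_mid]

instance : (indFunctor φ).Linear k where
  map_smul {X Y} f c := induced_hom_ext φ fun x => by
    change ind φ 1 (c • f.hom x) 1 = c • (ind φ 1 (f.hom x) 1 : induced φ Y)
    rw [smul_eq_leftAct, smul_eq_leftAct, leftAct_ind, ind_leftAct, AlgHom.commutes, one_mul,
      mul_one]

instance : Limits.PreservesColimits (indFunctor φ) := (indAdj φ).leftAdjoint_preservesColimits

instance : (indFunctor φ).PreservesProjectiveObjects :=
  Functor.preservesProjectiveObjects_of_adjunction_of_preservesEpimorphisms (indAdj φ)

lemma _root_.Function.Exact.of_ladder_addEquiv {M₁ M₂ M₃ N₁ N₂ N₃ : Type*} [AddCommGroup M₁]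
    [AddCommGroup M₂] [AddCommGroup M₃] [AddCommGroup N₁] [AddCommGroup N₂] [AddCommGroup N₃]
    {f : M₁ → M₂} {g : M₂ → M₃} {f' : N₁ → N₂} {g' : N₂ → N₃} (h : Function.Exact f g)
    (e₁ : M₁ ≃+ N₁) (e₂ : M₂ ≃+ N₂) (e₃ : M₃ ≃+ N₃) (h₁ : ∀ x, f' (e₁ x) = e₂ (f x))
    (h₂ : ∀ x, g' (e₂ x) = e₃ (g x)) : Function.Exact f' g' := by
  intro y
  obtain ⟨y, rfl⟩ := e₂.surjective y
  rw [h₂, EmbeddingLike.map_eq_zero_iff, h y]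
  constructor
  · rintro ⟨x, rfl⟩
    exact ⟨e₁ x, h₁ x⟩
  · rintro ⟨x, hx⟩
    obtain ⟨x, rfl⟩ := e₁.surjective x
    exact ⟨x, e₂.injective (by rw [← h₁, hx])⟩

lemma BalTensor.addHom_ext {ι : Type*} {N M : Type u} {P : Type*} [AddCommGroup N] [Module k N]
    [AddCommGroup M] [Module k M] [AddCommGroup P] {ρ : ι → Module.End k N}
    {σ : ι → Module.End k M} {f g : BalTensor ρ σ →+ P}
    (h : ∀ n m, f (BalTensor.mk ρ σ (n ⊗ₜ m)) = g (BalTensor.mk ρ σ (n ⊗ₜ m))) : f = g := by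
  ext t
  obtain ⟨t, rfl⟩ := BalTensor.mk_surjective t
  induction t using TensorProduct.induction_on with
  | zero => simp
  | tmul n m => exact h n m
  | add s t hs ht => rw [map_add, map_add, map_add, hs, ht]

/-- Identification of a balanced tensor product with a tensor product of bimodules. -/
def balEquiv {N M : Type u} [AddCommGroup N] [Module k N] [AddCommGroup M] [Module k M]
    {ρ : B → Module.End k N} {σ : B → Module.End k M} {X : BimodCat k A B} {Y : BimodCat k B C}
    (eN : N ≃+ X) (eM : M ≃+ Y) (hN : ∀ (c : k) n, eN (c • n) = c • eN n)
    (hM : ∀ (c : k) m, eM (c • m) = c • eM m) (hρ : ∀ b n, eN (ρ b n) = rightAct X b (eN n))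
    (hσ : ∀ b m, eM (σ b m) = leftAct Y b (eM m)) : BalTensor ρ σ ≃+ tensor X Y :=
  AddMonoidHom.toAddEquiv
    (BalTensor.liftAdd (biadd (fun n m => tm (eN n) (eM m)) (by simp [add_tm]) (by simp [tm_add]))
      (fun c n m => by
        change tm (eN (c • n)) (eM m) = tm (eN n) (eM (c • m))
        rw [hN, hM, smul_eq_rightAct, smul_eq_leftAct, tm_balanced])
      (fun b n m => by
        change tm (eN (ρ b n)) (eM m) = tm (eN n) (eM (σ b m))
        rw [hρ, hσ, tm_balanced]))
    (tlift (fun x y => BalTensor.mk ρ σ (eN.symm x ⊗ₜ eM.symm y))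
      (by simp [add_tmul]) (by simp [tmul_add])
      (fun b x y => by
        rw [show eN.symm (rightAct X b x) = ρ b (eN.symm x) by simp [AddEquiv.symm_apply_eq, hρ],
          show eM.symm (leftAct Y b y) = σ b (eM.symm y) by simp [AddEquiv.symm_apply_eq, hσ],
          BalTensor.mk_rel]))
    (BalTensor.addHom_ext fun n m => by
      change BalTensor.mk ρ σ (eN.symm (eN n) ⊗ₜ eM.symm (eM m)) = _
      simp)
    (tensor_addHom_ext fun x y => by
      change tm (eN (eN.symm x)) (eM (eM.symm y)) = tm x y
      simp)

variable {φ}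

/-- If `B ⊗_A -` is exact on left modules, it is exact on bimodules. -/
lemma exact_tensorMap (h : TensorLeftExact φ) {X₁ X₂ X₃ : BimodCat k A C} (f : X₁ ⟶ X₂)
    (g : X₂ ⟶ X₃) (hfg : Function.Exact f.hom g.hom) :
    Function.Exact (tensorMap (bimodBA φ) f).hom (tensorMap (bimodBA φ) g).hom := by
  let I (X : BimodCat k A C) : Module A X :=
    Module.compHom X (Algebra.TensorProduct.includeLeft : A →ₐ[k] A ⊗[k] Cᵐᵒᵖ).toRingHom
  have J (X : BimodCat k A C) : IsScalarTower k A X :=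
    ⟨fun c a x => by
      change leftAct X (c • a) x = c • leftAct X a x
      rw [smul_eq_leftAct, ← leftAct_mul, Algebra.smul_def]⟩
  let f' : X₁ →ₗ[A] X₂ := { f.hom.toAddMonoidHom with map_smul' := fun a x => hom_leftAct f a x }
  let g' : X₂ →ₗ[A] X₃ := { g.hom.toAddMonoidHom with map_smul' := fun a x => hom_leftAct g a x }
  let e (X : BimodCat k A C) :
      BalTensor (k := k) (fun a : A => LinearMap.mulRight k (φ a))
        (fun a : A => Algebra.lsmul k k X a) ≃+ tensor (bimodBA φ) X :=
    balEquiv (bBA φ) (AddEquiv.refl X)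
      (fun c b => by
        rw [smul_eq_leftAct, leftAct_bBA, Algebra.smul_def])
      (fun _ _ => rfl) (fun a b => by rw [rightAct_bBA]; rfl) (fun _ _ => rfl)
  have hB := h X₁ X₂ X₃ f' g' hfg
  refine hB.of_ladder_addEquiv (e X₁) (e X₂) (e X₃) (fun t => ?_) (fun t => ?_)
  · obtain ⟨t, rfl⟩ := BalTensor.mk_surjective t
    induction t using TensorProduct.induction_on with
    | zero => simp only [map_zero]
    | tmul n m => rfl
    | add s t hs ht => simp only [map_add, hs, ht]
  · obtain ⟨t, rfl⟩ := BalTensor.mk_surjective t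
    induction t using TensorProduct.induction_on with
    | zero => simp only [map_zero]
    | tmul n m => rfl
    | add s t hs ht => simp only [map_add, hs, ht]

/-- If `- ⊗_A B` is exact on right modules, it is exact on bimodules. -/
lemma exact_tensorMapLeft (h : TensorRightExact φ) {X₁ X₂ X₃ : BimodCat k C A} (f : X₁ ⟶ X₂)
    (g : X₂ ⟶ X₃) (hfg : Function.Exact f.hom g.hom) :
    Function.Exact (tensorMapLeft f (bimodAB φ)).hom (tensorMapLeft g (bimodAB φ)).hom := by
  let I (X : BimodCat k C A) : Module Aᵐᵒᵖ X :=
    Module.compHom X (Algebra.TensorProduct.includeRight : Aᵐᵒᵖ →ₐ[k] C ⊗[k] Aᵐᵒᵖ).toRingHom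
  have J (X : BimodCat k C A) : IsScalarTower k Aᵐᵒᵖ X :=
    ⟨fun c a x => by
      change rightAct X (c • a.unop) x = c • rightAct X a.unop x
      rw [smul_eq_rightAct, ← rightAct_mul, Algebra.smul_def, Algebra.commutes]⟩
  let f' : X₁ →ₗ[Aᵐᵒᵖ] X₂ :=
    { f.hom.toAddMonoidHom with map_smul' := fun a x => hom_rightAct f a.unop x }
  let g' : X₂ →ₗ[Aᵐᵒᵖ] X₃ :=
    { g.hom.toAddMonoidHom with map_smul' := fun a x => hom_rightAct g a.unop x }
  let e (X : BimodCat k C A) :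
      BalTensor (k := k) (fun a : A => Algebra.lsmul k k X (op a))
        (fun a : A => LinearMap.mulLeft k (φ a)) ≃+ tensor X (bimodAB φ) :=
    balEquiv (AddEquiv.refl X) (bAB φ) (fun _ _ => rfl)
      (fun c b => by
        rw [smul_eq_rightAct, rightAct_bAB, Algebra.smul_def, Algebra.commutes])
      (fun _ _ => rfl) (fun a b => by rw [leftAct_bAB]; rfl)
  have hB := h X₁ X₂ X₃ f' g' hfg
  refine hB.of_ladder_addEquiv (e X₁) (e X₂) (e X₃) (fun t => ?_) (fun t => ?_)
  · obtain ⟨t, rfl⟩ := BalTensor.mk_surjective t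
    induction t using TensorProduct.induction_on with
    | zero => simp only [map_zero]
    | tmul n m => rfl
    | add s t hs ht => simp only [map_add, hs, ht]
  · obtain ⟨t, rfl⟩ := BalTensor.mk_surjective t
    induction t using TensorProduct.induction_on with
    | zero => simp only [map_zero]
    | tmul n m => rfl
    | add s t hs ht => simp only [map_add, hs, ht]

/-- Under the flatness hypotheses, the functor `B ⊗_A - ⊗_A B` is exact. -/
lemma preservesFiniteLimits_indFunctor (hl : TensorLeftExact φ) (hr : TensorRightExact φ) :
    Limits.PreservesFiniteLimits (indFunctor φ) := by
  have : ∀ S : ShortComplex (BimodCat k A A), S.Exact → (S.map (indFunctor φ)).Exact := by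
    intro S hS
    rw [ShortComplex.ShortExact.moduleCat_exact_iff_function_exact] at hS ⊢
    exact exact_tensorMapLeft hr _ _ (exact_tensorMap hl _ _ hS)
  have h : Limits.PreservesFiniteLimits (indFunctor φ) ∧
      Limits.PreservesFiniteColimits (indFunctor φ) :=
    ((indFunctor φ).exact_tfae.out 1 3).1 this
  exact h.1

variable (φ)

/-- Induction of bimodules preserves finite generation. -/
lemma finite_induced (X : BimodCat k A A) [hX : Module.Finite (A ⊗[k] Aᵐᵒᵖ) X] :
    Module.Finite (B ⊗[k] Bᵐᵒᵖ) (induced φ X) := by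
  obtain ⟨S, hS⟩ := hX
  classical
  refine ⟨S.image (fun x => ind φ 1 x 1), ?_⟩
  set T := Submodule.span (B ⊗[k] Bᵐᵒᵖ) (SetLike.coe (S.image (fun x : X => ind φ 1 x 1)))
    with hT
  have h₁ (x : X) : ind φ 1 x 1 ∈ T := by
    have hx : x ∈ Submodule.span (A ⊗[k] Aᵐᵒᵖ) (S : Set X) := hS ▸ Submodule.mem_top
    induction hx using Submodule.span_induction with
    | mem x hx => exact Submodule.subset_span (Finset.mem_image_of_mem _ hx)
    | zero =>
      have : ind φ 1 (0 : X) 1 = 0 := (indUnit φ X).hom.map_zero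
      rw [this]
      exact T.zero_mem
    | add x y _ _ hx hy => rw [ind_add_mid]; exact T.add_mem hx hy
    | smul r x _ hx =>
      have : ind φ 1 (r • x) 1 =
          (Algebra.TensorProduct.map φ (AlgHom.op φ) r) • ind φ 1 x 1 :=
        (indUnit φ X).hom.map_smul r x
      rw [this]
      exact T.smul_mem _ hx
  rw [eq_top_iff]
  rintro t -
  have h₂ : T.mkQ.toAddMonoidHom = 0 := induced_addHom_ext φ fun b x b' => by
    refine (Submodule.Quotient.mk_eq_zero T).2 ?_
    have : ind φ b x b' = (b ⊗ₜ[k] op b') • ind φ 1 x 1 := by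
      rw [tmul_smul_eq]
      simp
    rw [this]
    exact T.smul_mem _ (h₁ x)
  exact (Submodule.Quotient.mk_eq_zero T).1 (DFunLike.congr_fun h₂ t)

/-! #### Induction of the free bimodule of rank one -/

/-- The algebra map `A^e → B^e`. -/
abbrev envMap : A ⊗[k] Aᵐᵒᵖ →ₐ[k] B ⊗[k] Bᵐᵒᵖ := Algebra.TensorProduct.map φ (AlgHom.op φ)

/-- The algebra map `A^e → B^e` as a map of `A`-bimodules. -/
def envMapHom : envRegular k A ⟶ restrict φ φ (envRegular k B) :=
  ModuleCat.ofHom (Y := (restrict φ φ (envRegular k B) : BimodCat k A A))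
    { toFun := fun r => res φ φ (envRegular k B) (envMap φ r)
      map_add' := fun r s => by rw [map_add, map_add]
      map_smul' := fun r s => by
        rw [smul_eq_mul, map_mul]
        rfl }

/-- The canonical map `B ⊗_A A^e ⊗_A B → B^e`. -/
def indEnvHom : induced φ (envRegular k A) ⟶ envRegular k B :=
  (indFunctor φ).map (envMapHom φ) ≫ indCounit φ (envRegular k B)

lemma indEnvHom_ind (r : A ⊗[k] Aᵐᵒᵖ) :
    (indEnvHom φ).hom (ind φ 1 (r : envRegular k A) 1) = envMap φ r := by
  change (indCounit φ (envRegular k B)).hom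
    (ind φ 1 (res φ φ (envRegular k B) (envMap φ r)) 1) = _
  rw [indCounit_ind, leftAct_one, rightAct_one, AddEquiv.symm_apply_apply]

instance isIso_indEnvHom : IsIso (indEnvHom φ) := by
  let u : induced φ (envRegular k A) := ind φ 1 (1 : A ⊗[k] Aᵐᵒᵖ) 1
  let g : envRegular k B ⟶ induced φ (envRegular k A) :=
    ModuleCat.ofHom (LinearMap.toSpanSingleton _ _ u)
  refine ⟨g, induced_hom_ext φ fun r => ?_, ModuleCat.hom_ext (LinearMap.ext_ring ?_)⟩
  · change (indEnvHom φ).hom (ind φ 1 (r : envRegular k A) 1) • u = ind φ 1 r 1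
    rw [indEnvHom_ind]
    refine ((indUnit φ (envRegular k A)).hom.map_smul r (1 : A ⊗[k] Aᵐᵒᵖ)).symm.trans ?_
    rw [smul_eq_mul, mul_one]
    rfl
  · change (indEnvHom φ).hom ((1 : B ⊗[k] Bᵐᵒᵖ) • u) = 1
    rw [one_smul, indEnvHom_ind, map_one]

end Exactness

/-! ### The dualizing bimodule of the localization -/

section Dualizing

variable {k : Type w} [Field k] {A B : Type u} [Ring A] [Algebra k A] [Ring B] [Algebra k B]
  (φ : A →ₐ[k] B)

/-- `B` as an `A`-bimodule, in a form that unfolds to a restriction. -/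
abbrev resB : BimodCat k A A := restrict φ φ (regular k B)

section

variable (U : BimodCat k A A) (M : BimodCat k B B)

lemma inducedTensor_addHom_ext {P : Type*} [AddCommGroup P] {f g : tensor (induced φ U) M →+ P}
    (h : ∀ b u b' m, f (tm (ind φ b u b') m) = g (tm (ind φ b u b') m)) : f = g :=
  tensor_addHom_ext fun v m => DFunLike.congr_fun (induced_addHom_ext φ
    (f := f.comp ((tmHom (induced φ U) M).flip m)) (g := g.comp ((tmHom (induced φ U) M).flip m))
    fun b u b' => h b u b' m) v

/-- The map `b ⊗ u ⊗ b' ↦ (b ⊗ u) ⊗ b' m`. -/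
def inducedTensorInvAux (m : M) : induced φ U →+ tensor (tensor (resB φ) U) (restrict φ φ M) :=
  indLift φ (fun b u b' => tm (tm (resReg φ φ b) u) (res φ φ M (leftAct M b' m)))
    (by simp [add_tm]) (by simp [add_tm, tm_add]) (by simp [leftAct_add, tm_add])
    (by simp [← tm_balanced])
    (fun a b u b' => by rw [leftAct_mul, ← leftAct_res, ← tm_balanced, rightAct_tm])

lemma inducedTensorInvAux_ind (m : M) (b : B) (u : U) (b' : B) :
    inducedTensorInvAux φ U M m (ind φ b u b') =
      tm (tm (resReg φ φ b) u) (res φ φ M (leftAct M b' m)) := rfl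

/-- The map `(b ⊗ u ⊗ b') ⊗ m ↦ (b ⊗ u) ⊗ b' m`. -/
def inducedTensorInv :
    tensor (induced φ U) M →+ tensor (tensor (resB φ) U) (restrict φ φ M) :=
  tlift (fun v m => inducedTensorInvAux φ U M m v) (fun _ _ _ => map_add _ _ _)
    (fun v m m' => DFunLike.congr_fun (f := inducedTensorInvAux φ U M (m + m'))
      (g := inducedTensorInvAux φ U M m + inducedTensorInvAux φ U M m')
      (induced_addHom_ext φ fun b u b' => by
        simp only [AddMonoidHom.add_apply, inducedTensorInvAux_ind, map_add, tm_add]) v)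
    (fun c v m => DFunLike.congr_fun
      (f := (inducedTensorInvAux φ U M m).comp (rightAct (induced φ U) c).toAddMonoidHom)
      (g := inducedTensorInvAux φ U M (leftAct M c m))
      (induced_addHom_ext φ fun b u b' => by
        change inducedTensorInvAux φ U M m (rightAct (induced φ U) c (ind φ b u b')) = _
        rw [rightAct_ind, inducedTensorInvAux_ind, inducedTensorInvAux_ind, leftAct_mul]) v)

lemma inducedTensorInv_tm (b : B) (u : U) (b' : B) (m : M) :
    inducedTensorInv φ U M (tm (ind φ b u b') m) =
      tm (tm (resReg φ φ b) u) (res φ φ M (leftAct M b' m)) := rfl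

/-- The map `(b ⊗ u) ⊗ m ↦ (b ⊗ u ⊗ 1) ⊗ m`. -/
def inducedTensorHom :
    tensor (tensor (resB φ) U) (restrict φ φ M) ⟶ restrict φ φ (tensor (induced φ U) M) :=
  tlift₃Hom (fun b u m => res φ φ (tensor (induced φ U) M)
      (tm (ind φ ((resReg φ φ).symm b) u 1) ((res φ φ M).symm m)))
    (by simp [ind_add_left, add_tm]) (by simp [ind_add_mid, add_tm]) (by simp [tm_add])
    (by simp [ind_leftAct])
    (fun a b u m => by
      rw [ind_rightAct, res_symm_leftAct, ← tm_balanced, rightAct_ind, one_mul, mul_one])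
    (by simp) (by simp)

lemma inducedTensorHom_tm (b : B) (u : U) (m : M) :
    (inducedTensorHom φ U M).hom (tm (tm (resReg φ φ b) u) (res φ φ M m)) =
      res φ φ _ (tm (ind φ b u 1) m) := rfl

/-- `(B ⊗_A U) ⊗_A M ≅ (B ⊗_A U ⊗_A B) ⊗_B M` for a `B`-bimodule `M`. -/
def inducedTensorIso :
    tensor (tensor (resB φ) U) (restrict φ φ M) ≅ restrict φ φ (tensor (induced φ U) M) :=
  mkIso (inducedTensorHom φ U M)
    ((inducedTensorInv φ U M).comp (res φ φ (tensor (induced φ U) M)).symm.toAddMonoidHom)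
    (triple_addHom_ext fun b u m => by
      obtain ⟨b, rfl⟩ := (resReg φ φ).surjective b
      obtain ⟨m, rfl⟩ := (res φ φ M).surjective m
      change inducedTensorInv φ U M (tm (ind φ b u 1) m) = _
      rw [inducedTensorInv_tm, leftAct_one]
      rfl)
    (inducedTensor_addHom_ext φ U M fun b u b' m => by
      change (inducedTensorHom φ U M).hom (inducedTensorInv φ U M (tm (ind φ b u b') m)) = _
      rw [inducedTensorInv_tm, inducedTensorHom_tm, ← tm_balanced, rightAct_ind, one_mul]
      rfl)

end

/-- The tensor product `X ⊗_A -` depends functorially on `X`. -/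
def tensorFunctorIso {X X' : BimodCat k A A} (e : X ≅ X') :
    tensorFunctor A X ≅ tensorFunctor A X' :=
  NatIso.ofComponents (fun Y => (tensorRightFunctor A Y).mapIso e)
    (fun _ => tensor_hom_ext fun _ _ => rfl)

/-- Associativity as an isomorphism of functors. -/
def assocFunctorIso (X Y : BimodCat k A A) :
    tensorFunctor A (tensor X Y) ≅ tensorFunctor A Y ⋙ tensorFunctor A X :=
  NatIso.ofComponents (fun Z => assoc X Y Z) (fun _ => triple_hom_ext fun _ _ _ => rfl)

/-- `B ⊗_A M ≅ M` naturally in the `B`-bimodule `M`. -/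
def mulLeftFunctorIso (hmul : Function.Injective (mulMap φ)) :
    resFunctor φ ⋙ tensorFunctor A (resB φ) ≅ resFunctor φ :=
  NatIso.ofComponents (fun M => mulLeftIso φ hmul φ φ M)
    (fun f => tensor_hom_ext fun _ _ => (hom_leftAct f _ _).symm)

/-- `inducedTensorIso` as an isomorphism of functors. -/
def inducedTensorNatIso (U : BimodCat k A A) :
    resFunctor φ ⋙ tensorFunctor A (tensor (resB φ) U) ≅
      tensorFunctor B (induced φ U) ⋙ resFunctor φ :=
  NatIso.ofComponents (fun M => inducedTensorIso φ U M) (fun _ => triple_hom_ext fun _ _ _ => rfl)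

variable {φ}

/-- If `B ⊗_A U ≅ U ⊗_A B`, then `(B ⊗_A U ⊗_A B) ⊗_B M ≅ U ⊗_A M` as `A`-bimodules, naturally in
the `B`-bimodule `M`. -/
def inducedTensorFunctorIso (hmul : Function.Injective (mulMap φ)) {U : BimodCat k A A}
    (σ : tensor (resB φ) U ≅ tensor U (resB φ)) :
    tensorFunctor B (induced φ U) ⋙ resFunctor φ ≅ resFunctor φ ⋙ tensorFunctor A U :=
  (inducedTensorNatIso φ U).symm ≪≫ Functor.isoWhiskerLeft (resFunctor φ) (tensorFunctorIso σ) ≪≫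
    Functor.isoWhiskerLeft (resFunctor φ) (assocFunctorIso U (resB φ)) ≪≫
    Functor.isoWhiskerRight (mulLeftFunctorIso φ hmul) (tensorFunctor A U)

/-- An inverse `Q` of a bimodule `U` commutes with every bimodule that `U` commutes with. -/
lemma invertible_commutes {Q U L : BimodCat k A A}
    (h₁ : tensor U Q ≅ regular k A) (h₂ : tensor Q U ≅ regular k A)
    (σ : tensor L U ≅ tensor U L) : Nonempty (tensor L Q ≅ tensor Q L) :=
  ⟨(tensorRightFunctor A Q).mapIso ((leftUnitor L).symm ≪≫
      (tensorRightFunctor A L).mapIso h₂.symm ≪≫ assoc Q U L ≪≫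
      (tensorFunctor A Q).mapIso σ.symm ≪≫ (assoc Q L U).symm) ≪≫
    assoc (tensor Q L) U Q ≪≫ (tensorFunctor A (tensor Q L)).mapIso h₁ ≪≫ rightUnitor (tensor Q L)⟩

/-- The tensor product of induced bimodules is `B` if the original bimodules are inverse to each
other and commute with `B`. -/
lemma induced_tensor_induced (hmul : Function.Injective (mulMap φ)) {U Q : BimodCat k A A}
    (h : tensor U Q ≅ regular k A) (σ : tensor (resB φ) U ≅ tensor U (resB φ))
    (τ : tensor (resB φ) Q ≅ tensor Q (resB φ)) :
    Nonempty (tensor (induced φ U) (induced φ Q) ≅ regular k B) :=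
  let e : restrict φ φ (induced φ Q) ≅ tensor Q (resB φ) :=
    (resFunctor φ).mapIso (rightUnitor (induced φ Q)).symm ≪≫
      (inducedTensorFunctorIso hmul τ).app (regular k B)
  ⟨(resFullyFaithful φ hmul).preimageIso <|
    (inducedTensorFunctorIso hmul σ).app (induced φ Q) ≪≫ (tensorFunctor A U).mapIso e ≪≫
    (assoc U Q (resB φ)).symm ≪≫ (tensorRightFunctor A (resB φ)).mapIso h ≪≫
    leftUnitor (resB φ)⟩

/-- The bimodule induced from an invertible bimodule that commutes with `B` is invertible. -/
lemma isInvertible_induced (hmul : Function.Injective (mulMap φ)) {U : BimodCat k A A}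
    (hU : IsInvertible U) (σ : tensor (resB φ) U ≅ tensor U (resB φ)) :
    IsInvertible (induced φ U) := by
  obtain ⟨Q, ⟨h₁⟩, ⟨h₂⟩⟩ := hU
  obtain ⟨τ⟩ := invertible_commutes h₁ h₂ σ
  exact ⟨induced φ Q, induced_tensor_induced hmul h₁ σ τ, induced_tensor_induced hmul h₂ τ σ⟩

variable (φ) in
/-- For a `B`-`A`-bimodule `T`, the right `A`-module underlying `T ⊗_A B`. -/
def tensorResIso (T : BimodCat k B A) :
    tensor T (resB φ) ≅ restrict (AlgHom.id k B) φ (tensor T (bimodAB φ)) :=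
  mkIso
    (tliftHom (fun t b => res (AlgHom.id k B) φ (tensor T (bimodAB φ))
        (tm t (bAB φ ((resReg φ φ).symm b))))
      (by simp [add_tm]) (by simp [tm_add]) (by simp [tm_balanced]) (by simp) (by simp))
    ((tlift (fun t b => tm t (resReg φ φ ((bAB φ).symm b)))
      (by simp [add_tm]) (by simp [tm_add]) (by simp [tm_balanced])).comp
      (res (AlgHom.id k B) φ (tensor T (bimodAB φ))).symm.toAddMonoidHom)
    (tensor_addHom_ext fun _ _ => rfl)
    (tensor_addHom_ext (X := T) (Y := bimodAB φ) fun _ _ => rfl)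

/-- If `B ⊗_A U ≅ U ⊗_A B` as `A`-bimodules, then `B ⊗_A U ≅ B ⊗_A U ⊗_A B` as
`B`-`A`-bimodules. -/
def tensorIsoRestrictInduced (hmul : Function.Injective (mulMap φ)) {U : BimodCat k A A}
    (σ : tensor (resB φ) U ≅ tensor U (resB φ)) :
    tensor (bimodBA φ) U ≅ restrict (AlgHom.id k B) φ (induced φ U) :=
  (tensorRightFunctor B U).mapIso
      (mulLeftIso φ hmul (AlgHom.id k B) φ (regular k B)).symm ≪≫
    assoc (bimodBA φ) (resB φ) U ≪≫ (tensorFunctor A (bimodBA φ)).mapIso σ ≪≫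
    (assoc (bimodBA φ) U (resB φ)).symm ≪≫ tensorResIso φ (tensor (bimodBA φ) U)

end Dualizing

/-! ### Hochschild homology of the localization -/

section LeftDerived

open CategoryTheory

variable {C D E : Type*} [Category* C] [Category* D] [Category* E] [Abelian C] [Abelian D]
  [Abelian E]

variable (F : C ⥤ D) [F.Additive] [F.PreservesHomology] [F.PreservesProjectiveObjects]

/-- The homology of `T(F(P))` for a projective resolution `P`, in its two presentations. -/
def homologyCompIso (T : D ⥤ E) [T.Additive] (n : ℕ) {X : C} (P : ProjectiveResolution X) :
    (HomologicalComplex.homologyFunctor E _ n).obj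
        (((F ⋙ T).mapHomologicalComplex _).obj P.complex) ≅
      (HomologicalComplex.homologyFunctor E _ n).obj
        ((T.mapHomologicalComplex _).obj (F.mapProjectiveResolution P).complex) :=
  Iso.refl _

lemma homologyCompIso_naturality {T T' : D ⥤ E} [T.Additive] [T'.Additive] (α : T ⟶ T') (n : ℕ)
    {X : C} (P : ProjectiveResolution X) :
    (HomologicalComplex.homologyFunctor E _ n).map
        ((NatTrans.mapHomologicalComplex (Functor.whiskerLeft F α) _).app P.complex) ≫
        (homologyCompIso F T' n P).hom =
      (homologyCompIso F T n P).hom ≫ (HomologicalComplex.homologyFunctor E _ n).map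
        ((NatTrans.mapHomologicalComplex α _).app (F.mapProjectiveResolution P).complex) :=
  (Category.comp_id _).trans (Category.id_comp _).symm

variable [HasProjectiveResolutions C] [HasProjectiveResolutions D]

/-- If `F` is exact and preserves projective objects, the left derived functors of `F ⋙ T` are
those of `T` evaluated at the values of `F`. -/
def leftDerivedCompIso (T : D ⥤ E) [T.Additive] (n : ℕ) {X : C} (P : ProjectiveResolution X) :
    ((F ⋙ T).leftDerived n).obj X ≅ (T.leftDerived n).obj (F.obj X) :=
  P.isoLeftDerivedObj (F ⋙ T) n ≪≫ homologyCompIso F T n P ≪≫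
    ((F.mapProjectiveResolution P).isoLeftDerivedObj T n).symm

lemma leftDerivedCompIso_naturality {T T' : D ⥤ E} [T.Additive] [T'.Additive] (α : T ⟶ T')
    (n : ℕ) {X : C} (P : ProjectiveResolution X) :
    (NatTrans.leftDerived (Functor.whiskerLeft F α) n).app X ≫
        (leftDerivedCompIso F T' n P).hom =
      (leftDerivedCompIso F T n P).hom ≫ (NatTrans.leftDerived α n).app (F.obj X) := by
  have h := homologyCompIso_naturality F α n P
  rw [ProjectiveResolution.leftDerived_app_eq _ P,
    ProjectiveResolution.leftDerived_app_eq _ (F.mapProjectiveResolution P)]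
  simp only [leftDerivedCompIso, Iso.trans_hom, Iso.symm_hom, Category.assoc,
    Iso.inv_hom_id_assoc]
  rw [reassoc_of% h]

/-- If `S ≅ F ⋙ T` with `F` exact and preserving projective objects, the left derived functors of
`S` at `X` are those of `T` at `F.obj X`. -/
def leftDerivedIsoOfComp {S : C ⥤ E} [S.Additive] {T : D ⥤ E} [T.Additive] (β : S ≅ F ⋙ T) (n : ℕ)
    {X : C} (P : ProjectiveResolution X) {Z : D} (e : F.obj X ≅ Z) :
    (S.leftDerived n).obj X ≅ (T.leftDerived n).obj Z :=
  { hom := (NatTrans.leftDerived β.hom n).app X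
    inv := (NatTrans.leftDerived β.inv n).app X
    hom_inv_id := by
      rw [← NatTrans.comp_app, ← NatTrans.leftDerived_comp, Iso.hom_inv_id,
        NatTrans.leftDerived_id, NatTrans.id_app]
    inv_hom_id := by
      rw [← NatTrans.comp_app, ← NatTrans.leftDerived_comp, Iso.inv_hom_id,
        NatTrans.leftDerived_id, NatTrans.id_app] : _ ≅ ((F ⋙ T).leftDerived n).obj X } ≪≫
  leftDerivedCompIso F T n P ≪≫ (T.leftDerived n).mapIso e

lemma leftDerivedIsoOfComp_naturality {S S' : C ⥤ E} [S.Additive] [S'.Additive] {T T' : D ⥤ E}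
    [T.Additive] [T'.Additive] (β : S ≅ F ⋙ T) (β' : S' ≅ F ⋙ T') (γ : S ⟶ S') (α : T ⟶ T')
    (h : γ ≫ β'.hom = β.hom ≫ Functor.whiskerLeft F α) (n : ℕ) {X : C}
    (P : ProjectiveResolution X) {Z : D} (e : F.obj X ≅ Z) :
    (NatTrans.leftDerived γ n).app X ≫ (leftDerivedIsoOfComp F β' n P e).hom =
      (leftDerivedIsoOfComp F β n P e).hom ≫ (NatTrans.leftDerived α n).app Z := by
  have h' := congrArg (fun τ => (NatTrans.leftDerived τ n).app X) h
  simp only [NatTrans.leftDerived_comp, NatTrans.comp_app] at h'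
  simp only [leftDerivedIsoOfComp, Iso.trans_hom, Functor.mapIso_hom, Category.assoc]
  rw [reassoc_of% h', reassoc_of% (leftDerivedCompIso_naturality F α n P),
    NatTrans.naturality]

end LeftDerived

section EnvTensor

variable {k : Type w} [Field k] {A B : Type u} [Ring A] [Algebra k A] [Ring B] [Algebra k B]

/-- The element `x ⊗ m` of `X ⊗_{A^e} M`. -/
def et {X M : BimodCat k A A} (x : X) (m : M) : EnvTensor X M :=
  BalTensor.mk _ _ (x ⊗ₜ m)

section et

variable {X M : BimodCat k A A}

lemma add_et (x x' : X) (m : M) : et (x + x') m = et x m + et x' m := by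
  rw [et, add_tmul, map_add]
  rfl

lemma et_add (x : X) (m m' : M) : et x (m + m') = et x m + et x m' := by
  rw [et, tmul_add, map_add]
  rfl

lemma envSwap_symm_tmul (a b : A) :
    (envSwap k A).symm (op (a ⊗ₜ op b)) = b ⊗ₜ op a := by
  rw [AlgEquiv.symm_apply_eq, envSwap_tmul]

lemma et_rightAct (a : A) (x : X) (m : M) : et (rightAct X a x) m = et x (leftAct M a m) := by
  have := BalTensor.mk_rel (k := k) (ρ := fun r => act X ((envSwap k A).symm (op r)))
    (σ := fun r => act M r) (a ⊗ₜ op 1) x m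
  rw [envSwap_symm_tmul] at this
  exact this

lemma et_leftAct (a : A) (x : X) (m : M) : et (leftAct X a x) m = et x (rightAct M a m) := by
  have := BalTensor.mk_rel (k := k) (ρ := fun r => act X ((envSwap k A).symm (op r)))
    (σ := fun r => act M r) (1 ⊗ₜ op a) x m
  rw [envSwap_symm_tmul] at this
  exact this

lemma smul_et (c : k) (x : X) (m : M) : c • et x m = et (c • x) m := by
  rw [et, ← map_smul, smul_tmul']
  rfl

/-- The additive map `x ⊗ m ↦ f x m` out of `X ⊗_{A^e} M` induced by a biadditive `f` that is
balanced over both actions. -/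
def etLift {P : Type*} [AddCommGroup P] (f : X → M → P)
    (h₁ : ∀ x x' m, f (x + x') m = f x m + f x' m) (h₂ : ∀ x m m', f x (m + m') = f x m + f x m')
    (hl : ∀ a x m, f (leftAct X a x) m = f x (rightAct M a m))
    (hr : ∀ a x m, f (rightAct X a x) m = f x (leftAct M a m)) : EnvTensor X M →+ P :=
  BalTensor.liftAdd (biadd f h₁ h₂)
    (fun c x m => by
      rw [smul_eq_leftAct, smul_eq_rightAct]
      exact hl _ x m)
    (fun r x m => by
      change f ((envSwap k A).symm (op r) • x) m = f x (r • m)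
      induction r using TensorProduct.induction_on with
      | zero =>
        have h0 : f 0 m = 0 := (biadd f h₁ h₂).flip m |>.map_zero
        have h0' : f x 0 = 0 := (biadd f h₁ h₂ x).map_zero
        rw [zero_smul (A ⊗[k] Aᵐᵒᵖ) m, MulOpposite.op_zero, map_zero]
        refine Eq.trans ?_ (h0.trans h0'.symm)
        exact congrArg (f · m) (zero_smul (A ⊗[k] Aᵐᵒᵖ) x)
      | add r s hr hs => rw [MulOpposite.op_add, map_add, add_smul, add_smul, h₁, h₂, hr, hs]
      | tmul a b =>
        obtain ⟨b, rfl⟩ := op_surjective b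
        rw [envSwap_symm_tmul, tmul_smul_eq, tmul_smul_eq, hl, unop_op, unop_op, hr,
          leftAct_rightAct])

lemma et_addHom_ext {P : Type*} [AddCommGroup P] {f g : EnvTensor X M →+ P}
    (h : ∀ x m, f (et x m) = g (et x m)) : f = g :=
  BalTensor.addHom_ext h

end et

variable (φ : A →ₐ[k] B) (X : BimodCat k A A) (N : BimodCat k B B)

/-- The map `x ⊗ n ↦ (1 ⊗ x ⊗ 1) ⊗ n`. -/
def etInducedHom : EnvTensor X (restrict φ φ N) →ₗ[k] EnvTensor (induced φ X) N :=
  let f : EnvTensor X (restrict φ φ N) →+ EnvTensor (induced φ X) N :=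
    etLift (fun x n => et (ind φ 1 x 1) ((res φ φ N).symm n))
      (by simp [ind_add_mid, add_et]) (by simp [et_add])
      (by simp [← et_leftAct, ind_leftAct]) (by simp [← et_rightAct, ind_rightAct])
  { f with
    map_smul' := fun c => DFunLike.congr_fun (et_addHom_ext
      (f := f.comp (DistribSMul.toAddMonoidHom (EnvTensor X (restrict φ φ N)) c))
      (g := (DistribSMul.toAddMonoidHom (EnvTensor (induced φ X) N) c).comp f) fun x n => by
        change f (c • et x n) = c • et (ind φ 1 x 1) ((res φ φ N).symm n)
        rw [smul_et, smul_et]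
        change et (ind φ 1 (c • x) 1) _ = _
        rw [smul_eq_leftAct, smul_eq_leftAct, ind_leftAct, leftAct_ind, AlgHom.commutes, one_mul,
          mul_one]) }

lemma etInducedHom_et (x : X) (n : N) :
    etInducedHom φ X N (et x (res φ φ N n)) = et (ind φ 1 x 1) n := rfl

/-- The map `b ⊗ x ⊗ b' ↦ x ⊗ b' n b`. -/
def etInducedInvAux (n : N) : induced φ X →+ EnvTensor X (restrict φ φ N) :=
  indLift φ (fun b x b' => et x (res φ φ N (leftAct N b' (rightAct N b n))))
    (by simp [rightAct_add, et_add]) (by simp [add_et]) (by simp [leftAct_add, et_add])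
    (by simp [et_leftAct, rightAct_mul, leftAct_rightAct])
    (by simp [et_rightAct, leftAct_mul])

lemma etInducedInvAux_ind (n : N) (b : B) (x : X) (b' : B) :
    etInducedInvAux φ X N n (ind φ b x b') =
      et x (res φ φ N (leftAct N b' (rightAct N b n))) := rfl

/-- The map `(b ⊗ x ⊗ b') ⊗ n ↦ x ⊗ b' n b`. -/
def etInducedInv : EnvTensor (induced φ X) N →+ EnvTensor X (restrict φ φ N) :=
  etLift (fun v n => etInducedInvAux φ X N n v) (fun _ _ _ => map_add _ _ _)
    (fun v n n' => DFunLike.congr_fun (f := etInducedInvAux φ X N (n + n'))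
      (g := etInducedInvAux φ X N n + etInducedInvAux φ X N n')
      (induced_addHom_ext φ fun b x b' => by
        simp only [AddMonoidHom.add_apply, etInducedInvAux_ind, map_add, et_add]) v)
    (fun c v n => DFunLike.congr_fun
      (f := (etInducedInvAux φ X N n).comp (leftAct (induced φ X) c).toAddMonoidHom)
      (g := etInducedInvAux φ X N (rightAct N c n))
      (induced_addHom_ext φ fun b x b' => by
        change etInducedInvAux φ X N n (leftAct (induced φ X) c (ind φ b x b')) = _
        rw [leftAct_ind, etInducedInvAux_ind, etInducedInvAux_ind, rightAct_mul]) v)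
    (fun c v n => DFunLike.congr_fun
      (f := (etInducedInvAux φ X N n).comp (rightAct (induced φ X) c).toAddMonoidHom)
      (g := etInducedInvAux φ X N (leftAct N c n))
      (induced_addHom_ext φ fun b x b' => by
        change etInducedInvAux φ X N n (rightAct (induced φ X) c (ind φ b x b')) = _
        rw [rightAct_ind, etInducedInvAux_ind, etInducedInvAux_ind, leftAct_mul,
          leftAct_rightAct]) v)

lemma etInducedInv_et (b : B) (x : X) (b' : B) (n : N) :
    etInducedInv φ X N (et (ind φ b x b') n) =
      et x (res φ φ N (leftAct N b' (rightAct N b n))) := rfl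

lemma etInducedHom_bijective : Function.Bijective (etInducedHom φ X N) := by
  have h₁ : (etInducedInv φ X N).comp (etInducedHom φ X N).toAddMonoidHom = AddMonoidHom.id _ :=
    et_addHom_ext fun x n => by
      obtain ⟨n, rfl⟩ := (res φ φ N).surjective n
      change etInducedInv φ X N (et (ind φ 1 x 1) n) = _
      rw [etInducedInv_et, leftAct_one, rightAct_one]
      rfl
  have h₂ : (etInducedHom φ X N).toAddMonoidHom.comp (etInducedInv φ X N) = AddMonoidHom.id _ :=
    et_addHom_ext fun v n => DFunLike.congr_fun (induced_addHom_ext φ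
      (f := ((etInducedHom φ X N).toAddMonoidHom.comp (etInducedInv φ X N)).comp
        (AddMonoidHom.mk' (fun v => et v n) fun _ _ => add_et _ _ _))
      (g := AddMonoidHom.mk' (fun v => et v n) fun _ _ => add_et _ _ _) fun b x b' => by
        change etInducedHom φ X N (etInducedInv φ X N (et (ind φ b x b') n)) =
          et (ind φ b x b') n
        rw [etInducedInv_et, etInducedHom_et, ← et_rightAct, ← et_leftAct, rightAct_ind,
          leftAct_ind, one_mul, mul_one]) v
  exact ⟨Function.LeftInverse.injective (DFunLike.congr_fun h₁),
    Function.RightInverse.surjective (DFunLike.congr_fun h₂)⟩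

/-- `X ⊗_{A^e} N ≅ (B ⊗_A X ⊗_A B) ⊗_{B^e} N`, naturally in the `A`-bimodule `X`. -/
def envTensorInducedIso :
    envTensorFunctor (restrict φ φ N) ≅ indFunctor φ ⋙ envTensorFunctor N :=
  NatIso.ofComponents
    (fun X => (LinearEquiv.ofBijective _ (etInducedHom_bijective φ X N)).toModuleIso)
    (fun _ => ModuleCat.hom_ext (BalTensor.hom_ext fun _ _ => rfl))

lemma envTensorInducedIso_naturality {N N' : BimodCat k B B} (g : N ⟶ N') :
    envTensorNat ((resFunctor φ).map g) ≫ (envTensorInducedIso φ N').hom =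
      (envTensorInducedIso φ N).hom ≫ Functor.whiskerLeft (indFunctor φ) (envTensorNat g) := by
  ext X : 2
  exact ModuleCat.hom_ext (BalTensor.hom_ext fun _ _ => rfl)

/-- Under the hypotheses of the localization theorem, `H_j(A, N) ≅ H_j(B, N)` naturally in the
`B`-bimodule `N`. -/
def homologyIso [Limits.PreservesFiniteLimits (indFunctor φ)]
    (hmul : Function.Injective (mulMap φ)) (j : ℕ) :
    resFunctor φ ⋙ hochschildHomology k A j ≅ hochschildHomology k B j :=
  let P : ProjectiveResolution (regular k A) := projectiveResolution (regular k A)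
  NatIso.ofComponents
    (fun N => leftDerivedIsoOfComp (indFunctor φ) (envTensorInducedIso φ N) j P
      (indRegular φ hmul))
    (fun g => leftDerivedIsoOfComp_naturality (indFunctor φ) _ _ _ (envTensorNat g)
      (envTensorInducedIso_naturality φ g) j P (indRegular φ hmul))

end EnvTensor

/-! ### Hochschild cohomology of the localization -/

section ExtAdjunction

open CategoryTheory Limits Abelian

universe w₁ w₂

section

variable {C : Type*} [Category* C] [Abelian C] [HasExt.{w₁} C] {S : ShortComplex C}
  (hS : S.ShortExact) (Y : C) (n : ℕ)

lemma ext_exact : Function.Exact ((Ext.mk₀ S.f).precomp Y (zero_add n))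
    (hS.extClass.precomp Y (add_comm 1 n)) :=
  (ShortComplex.ab_exact_iff_function_exact _).1
    (Ext.contravariant_sequence_exact₁' hS Y n (n + 1) (add_comm 1 n))

attribute [local instance] Ext.subsingleton_of_projective in
lemma extClass_precomp_surjective [Projective S.X₂] :
    Function.Surjective (hS.extClass.precomp Y (add_comm 1 n)) :=
  fun x => Ext.contravariant_sequence_exact₃ hS _ x (by subsingleton) (add_comm 1 n)

end

variable {C D : Type*} [Category* C] [Category* D] [Abelian C] [Abelian D] [HasExt.{w₁} C]
  [HasExt.{w₂} D] {F : C ⥤ D} {G : D ⥤ C} (adj : F ⊣ G) [F.Additive] [PreservesFiniteLimits F]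
  [PreservesFiniteColimits F]

/-- For an adjunction `F ⊣ G` with `F` exact, the map `Ext^n(X, G Y) → Ext^n(F X, Y)`. -/
def extAdjHom (X : C) (Y : D) (n : ℕ) : Ext X (G.obj Y) n →+ Ext (F.obj X) Y n :=
  ((Ext.mk₀ (adj.counit.app Y)).postcomp (F.obj X) (add_zero n)).comp
    (F.mapExtAddHom X (G.obj Y) n)

lemma extAdjHom_apply (X : C) (Y : D) (n : ℕ) (e : Ext X (G.obj Y) n) :
    extAdjHom adj X Y n e =
      (e.mapExactFunctor F).comp (Ext.mk₀ (adj.counit.app Y)) (add_zero n) := rfl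

lemma extAdjHom_comp {X X' : C} (Y : D) {m n p : ℕ} (x : Ext X X' m) (e : Ext X' (G.obj Y) n)
    (h : m + n = p) : extAdjHom adj X Y p (x.comp e h) =
      (x.mapExactFunctor F).comp (extAdjHom adj X' Y n e) h := by
  rw [extAdjHom_apply, extAdjHom_apply, Ext.mapExactFunctor_comp,
    Ext.comp_assoc_of_third_deg_zero]

lemma extAdjHom_naturality (X : C) {Y Y' : D} (g : Y ⟶ Y') (n : ℕ) (e : Ext X (G.obj Y) n) :
    extAdjHom adj X Y' n (e.comp (Ext.mk₀ (G.map g)) (add_zero n)) =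
      (extAdjHom adj X Y n e).comp (Ext.mk₀ g) (add_zero n) := by
  rw [extAdjHom_apply, extAdjHom_apply, Ext.mapExactFunctor_comp, Ext.mapExactFunctor_mk₀,
    Ext.comp_assoc_of_third_deg_zero, Ext.comp_assoc_of_third_deg_zero, Ext.mk₀_comp_mk₀,
    Ext.mk₀_comp_mk₀]
  exact congrArg (fun f => (e.mapExactFunctor F).comp (Ext.mk₀ f) (add_zero n))
    (adj.counit.naturality g)

lemma extAdjHom_smul {R : Type*} [Ring R] [Linear R C] [Linear R D] [F.Linear R] (X : C) (Y : D)
    (n : ℕ) (c : R) (e : Ext X (G.obj Y) n) :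
    extAdjHom adj X Y n (c • e) = c • extAdjHom adj X Y n e := by
  rw [extAdjHom_apply, extAdjHom_apply, Functor.mapExactFunctor_smul, Ext.smul_comp]

/-- If `F ⊣ G` with `F` exact and preserving projective objects, then
`Ext^n(X, G Y) = Ext^n(F X, Y)`. -/
lemma extAdjHom_bijective [EnoughProjectives C] [F.PreservesProjectiveObjects] (X : C) (Y : D)
    (n : ℕ) : Function.Bijective (extAdjHom adj X Y n) := by
  induction n generalizing X with
  | zero =>
    have : ⇑(extAdjHom adj X Y 0) =
        Ext.homEquiv₀.symm ∘ (adj.homEquiv X Y).symm ∘ Ext.homEquiv₀ := by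
      ext e
      obtain ⟨f, rfl⟩ := Ext.homEquiv₀.symm.surjective e
      change extAdjHom adj X Y 0 (Ext.mk₀ f) = _
      rw [extAdjHom_apply, Ext.mapExactFunctor_mk₀, Ext.mk₀_comp_mk₀]
      have hf : Ext.homEquiv₀ (Ext.mk₀ f) = f := Ext.homEquiv₀.right_inv f
      change _ = Ext.mk₀ ((adj.homEquiv X Y).symm (Ext.homEquiv₀ (Ext.mk₀ f)))
      rw [hf, Adjunction.homEquiv_counit]
    rw [this]
    exact Ext.homEquiv₀.symm.bijective.comp
      ((adj.homEquiv X Y).symm.bijective.comp Ext.homEquiv₀.bijective)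
  | succ n hn =>
    let P : ProjectivePresentation X := Classical.arbitrary _
    let S := ShortComplex.mk _ _ (kernel.condition P.f)
    have : Projective (S.map F).X₂ := Functor.PreservesProjectiveObjects.projective_obj P.projective
    have : Projective S.X₂ := P.projective
    have hS : S.ShortExact := { exact := ShortComplex.exact_kernel P.f }
    exact AddMonoidHom.bijective_of_surjective_of_bijective_of_right_exact
      ((Ext.mk₀ S.f).precomp (G.obj Y) (zero_add n))
      (hS.extClass.precomp (G.obj Y) (add_comm 1 n))
      ((Ext.mk₀ (S.map F).f).precomp Y (zero_add n))
      ((hS.map_of_exact F).extClass.precomp Y (add_comm 1 n))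
      (extAdjHom adj S.X₂ Y n) (extAdjHom adj S.X₁ Y n) (extAdjHom adj S.X₃ Y (n + 1))
      (AddMonoidHom.ext fun e => by
        refine Eq.trans ?_ (extAdjHom_comp adj Y (Ext.mk₀ S.f) e (zero_add n)).symm
        rw [Ext.mapExactFunctor_mk₀]
        rfl)
      (AddMonoidHom.ext fun e => by
        refine Eq.trans ?_ (extAdjHom_comp adj Y hS.extClass e (add_comm 1 n)).symm
        rw [Ext.mapExactFunctor_extClass]
        rfl)
      (ext_exact hS _ n) (ext_exact (hS.map_of_exact F) _ n) (hn _).surjective (hn _)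
      (extClass_precomp_surjective hS _ n) (extClass_precomp_surjective (hS.map_of_exact F) _ n)

end ExtAdjunction

section Cohomology

open Abelian

variable {k : Type w} [Field k] {A B : Type u} [Ring A] [Algebra k A] [Ring B] [Algebra k B]
  (φ : A →ₐ[k] B) [Limits.PreservesFiniteLimits (indFunctor φ)]

/-- The isomorphism `H^n(A, N) ≅ H^n(B, N)` for a `B`-bimodule `N`. -/
def cohomologyIsoApp (hmul : Function.Injective (mulMap φ)) (n : ℕ) (N : BimodCat k B B) :
    Ext.{u} (regular k A) (restrict φ φ N) n ≃ₗ[k] Ext.{u} (regular k B) N n :=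
  let e := Ext.mk₀ (indRegular φ hmul).inv
  LinearEquiv.ofBijective
    { (e.precomp N (zero_add n)).comp (extAdjHom (indAdj φ) (regular k A) N n) with
      map_smul' := fun c x => by
        change e.comp (extAdjHom (indAdj φ) (regular k A) N n (c • x)) (zero_add n) =
          c • e.comp (extAdjHom (indAdj φ) (regular k A) N n x) (zero_add n)
        exact (congrArg (fun y => e.comp y (zero_add n))
          (extAdjHom_smul (indAdj φ) (regular k A) N n c x)).trans (Ext.comp_smul _ _ _ _) }
    (by
      refine Function.Bijective.comp (g := e.precomp N (zero_add n)) ?_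
        (extAdjHom_bijective (indAdj φ) (regular k A) N n)
      refine Function.bijective_iff_has_inverse.2
        ⟨(Ext.mk₀ (indRegular φ hmul).hom).precomp N (zero_add n), fun x => ?_, fun x => ?_⟩
      · change (Ext.mk₀ _).comp ((Ext.mk₀ _).comp x (zero_add n)) (zero_add n) = x
        rw [Ext.mk₀_comp_mk₀_assoc, Iso.hom_inv_id, Ext.mk₀_id_comp]
      · change (Ext.mk₀ _).comp ((Ext.mk₀ _).comp x (zero_add n)) (zero_add n) = x
        rw [Ext.mk₀_comp_mk₀_assoc, Iso.inv_hom_id, Ext.mk₀_id_comp])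

/-- `H^n(A, N) ≅ H^n(B, N)` naturally in the `B`-bimodule `N`. -/
def cohomologyIso (hmul : Function.Injective (mulMap φ)) (n : ℕ) :
    resFunctor φ ⋙ hochschildCohomology k A n ≅ hochschildCohomology k B n :=
  NatIso.ofComponents (fun N => (cohomologyIsoApp φ hmul n N).toModuleIso) (fun g =>
    ModuleCat.hom_ext (LinearMap.ext fun x =>
      (congrArg (fun y => (Ext.mk₀ (indRegular φ hmul).inv).comp y (zero_add n))
        (extAdjHom_naturality (indAdj φ) (regular k A) g n x)).trans
      (Ext.comp_assoc_of_third_deg_zero _ _ _ _).symm))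

/-- Finiteness of the projective dimension passes to the localization. -/
lemma hasProjectiveDimensionLE_regular (hmul : Function.Injective (mulMap φ)) (n : ℕ)
    [HasProjectiveDimensionLE (regular k A) n] : HasProjectiveDimensionLE (regular k B) n := by
  have h : HasProjectiveDimensionLT (regular k A) (n + 1) := inferInstance
  rw [HasProjectiveDimensionLE, hasProjectiveDimensionLT_iff]
  intro i hi N e
  obtain ⟨x, rfl⟩ := (cohomologyIsoApp φ hmul i N).surjective e
  rw [x.eq_zero_of_hasProjectiveDimensionLT (n + 1) hi, map_zero]

end Cohomology

/-! ### The bimodules `Ext^n_{A^e}(A, A^e)` and induction -/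

section ExtInduction

open Abelian

variable {k : Type w} [Field k] {A B : Type u} [Ring A] [Algebra k A] [Ring B] [Algebra k B]

/-- The map of modules given by an equivariant map of groups. -/
def homOfSMul {R : Type*} [Ring R] {X Y : ModuleCat.{u} R} (f : X →+ Y)
    (h : ∀ (r : R) (x : X), f (r • x) = r • f x) : X ⟶ Y :=
  ModuleCat.ofHom { f with map_smul' := h }

/-- The bimodule `Ext^n_{A^e}(X, A^e)`; its bimodule structure is induced by the right
multiplication of `A^e` on itself, as for `extBimodule`, which is the case `X = A`. -/
def extBim (X : BimodCat k A A) (n : ℕ) : BimodCat k A A :=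
  letI : Module (A ⊗[k] Aᵐᵒᵖ) (Ext.{u} X (envRegular k A) n) :=
    Module.compHom _ (envSwap k A : A ⊗[k] Aᵐᵒᵖ →+* (A ⊗[k] Aᵐᵒᵖ)ᵐᵒᵖ)
  ModuleCat.of (A ⊗[k] Aᵐᵒᵖ) (Ext.{u} X (envRegular k A) n)

/-- The identity map from `Ext^n_{A^e}(X, A^e)` as a bimodule to the underlying group. -/
def toExt (X : BimodCat k A A) (n : ℕ) : extBim X n ≃+ Ext.{u} X (envRegular k A) n :=
  AddEquiv.refl _

lemma toExt_smul (X : BimodCat k A A) (n : ℕ) (r : A ⊗[k] Aᵐᵒᵖ) (e : extBim X n) :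
    toExt X n (r • e) =
      (toExt X n e).comp (Ext.mk₀ (rightMulHom _ (envSwap k A r).unop)) (add_zero n) := rfl

/-- Composition with a class in `Ext^m(X', X)`, as a map of bimodules
`Ext^n(X, A^e) → Ext^{m+n}(X', A^e)`. -/
def extPre {X X' : BimodCat k A A} {m n p : ℕ} (x : Ext.{u} X' X m) (h : m + n = p) :
    extBim X n ⟶ extBim X' p :=
  homOfSMul ((toExt X' p).symm.toAddMonoidHom.comp
      ((x.precomp (envRegular k A) h).comp (toExt X n).toAddMonoidHom)) fun r e => by
    apply (toExt X' p).injective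
    change x.comp (toExt X n (r • e)) h = _
    rw [toExt_smul, toExt_smul]
    exact (Ext.comp_assoc_of_third_deg_zero _ _ _ _).symm

lemma extPre_id (X : BimodCat k A A) (n : ℕ) : extPre (Ext.mk₀ (𝟙 X)) (zero_add n) = 𝟙 _ :=
  ModuleCat.hom_ext (LinearMap.ext fun e => Ext.mk₀_id_comp (toExt X n e))

lemma extPre_comp {X X' X'' : BimodCat k A A} (f : X ⟶ X') (g : X' ⟶ X'') (n : ℕ) :
    extPre (Ext.mk₀ g) (zero_add n) ≫ extPre (Ext.mk₀ f) (zero_add n) =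
      extPre (Ext.mk₀ (f ≫ g)) (zero_add n) :=
  ModuleCat.hom_ext (LinearMap.ext fun e => Ext.mk₀_comp_mk₀_assoc f g (toExt X'' n e))

lemma extPre_sum {X X' : BimodCat k A A} {ι : Type*} (s : Finset ι) (f : ι → (X' ⟶ X)) (n : ℕ) :
    ∑ i ∈ s, extPre (Ext.mk₀ (f i)) (zero_add n) =
      extPre (Ext.mk₀ (∑ i ∈ s, f i)) (zero_add n) := by
  let F : (X' ⟶ X) →+ (extBim X n ⟶ extBim X' n) :=
    AddMonoidHom.mk' (fun f => extPre (Ext.mk₀ f) (zero_add n)) fun f g =>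
      ModuleCat.hom_ext (LinearMap.ext fun e =>
        (congrArg (fun y => Ext.comp y (toExt X n e) (zero_add n)) (Ext.mk₀_add f g)).trans
          (Ext.add_comp _ _ _ _))
  exact (map_sum F f s).symm

/-- `Ext^n(-, A^e)` turns isomorphisms into isomorphisms. -/
def extBimIso {X X' : BimodCat k A A} (i : X ≅ X') (n : ℕ) : extBim X n ≅ extBim X' n where
  hom := extPre (Ext.mk₀ i.inv) (zero_add n)
  inv := extPre (Ext.mk₀ i.hom) (zero_add n)
  hom_inv_id := by rw [extPre_comp, i.hom_inv_id, extPre_id]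
  inv_hom_id := by rw [extPre_comp, i.inv_hom_id, extPre_id]

variable (φ : A →ₐ[k] B)

lemma envSwap_envMap (r : A ⊗[k] Aᵐᵒᵖ) :
    (envSwap k B (envMap φ r)).unop = envMap φ (envSwap k A r).unop := by
  induction r using TensorProduct.induction_on with
  | zero => simp
  | tmul a b => rfl
  | add r s hr hs =>
    rw [map_add, map_add, map_add]
    exact (congrArg₂ (· + ·) hr hs).trans (map_add (envMap φ) _ _).symm

lemma indEnvHom_rightMulHom (s : A ⊗[k] Aᵐᵒᵖ) :
    (indFunctor φ).map (rightMulHom (A ⊗[k] Aᵐᵒᵖ) s) ≫ indEnvHom φ =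
      indEnvHom φ ≫ rightMulHom (B ⊗[k] Bᵐᵒᵖ) (envMap φ s) :=
  induced_hom_ext φ fun r => by
    change (indEnvHom φ).hom (ind φ 1 ((r * s : A ⊗[k] Aᵐᵒᵖ) : envRegular k A) 1) =
      HMul.hMul (α := B ⊗[k] Bᵐᵒᵖ) ((indEnvHom φ).hom (ind φ 1 (r : envRegular k A) 1)) (envMap φ s)
    rw [indEnvHom_ind, indEnvHom_ind, map_mul]

variable [Limits.PreservesFiniteLimits (indFunctor φ)]

/-- The map `Ext^n_{A^e}(X, A^e) → Ext^n_{B^e}(B ⊗_A X ⊗_A B, B^e)`, as a map of groups. -/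
def extIndHom (X : BimodCat k A A) (n : ℕ) :
    extBim X n →+ Ext.{u} ((indFunctor φ).obj X) (envRegular k B) n :=
  (((Ext.mk₀ (indEnvHom φ)).postcomp ((indFunctor φ).obj X) (add_zero n)).comp
    ((indFunctor φ).mapExtAddHom X (envRegular k A) n)).comp (toExt X n).toAddMonoidHom

lemma extIndHom_apply (X : BimodCat k A A) (n : ℕ) (e : extBim X n) :
    extIndHom φ X n e = ((toExt X n e).mapExactFunctor (indFunctor φ)).comp
      (Ext.mk₀ (indEnvHom φ)) (add_zero n) := rfl

lemma extIndHom_smul (X : BimodCat k A A) (n : ℕ) (r : A ⊗[k] Aᵐᵒᵖ) (e : extBim X n) :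
    extIndHom φ X n (r • e) = (extIndHom φ X n e).comp
      (Ext.mk₀ (rightMulHom _ (envSwap k B (envMap φ r)).unop)) (add_zero n) := by
  rw [envSwap_envMap, extIndHom_apply, extIndHom_apply, toExt_smul, Ext.mapExactFunctor_comp,
    Ext.mapExactFunctor_mk₀, Ext.comp_assoc_of_third_deg_zero]
  refine Eq.trans ?_ (Ext.comp_assoc_of_third_deg_zero _ _ _ _).symm
  congr 1
  exact (Ext.mk₀_comp_mk₀ _ _).trans ((congrArg Ext.mk₀ (indEnvHom_rightMulHom φ _)).trans
    (Ext.mk₀_comp_mk₀ _ _).symm)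

/-- The map `Ext^n_{A^e}(X, A^e) → Ext^n_{B^e}(B ⊗_A X ⊗_A B, B^e)`, as a map of
`A`-bimodules. -/
def extInd (X : BimodCat k A A) (n : ℕ) :
    extBim X n ⟶ (resFunctor φ).obj (extBim ((indFunctor φ).obj X) n) :=
  homOfSMul ((res φ φ (extBim ((indFunctor φ).obj X) n)).toAddMonoidHom.comp
      ((toExt ((indFunctor φ).obj X) n).symm.toAddMonoidHom.comp (extIndHom φ X n))) fun r e =>
    extIndHom_smul φ X n r e

/-- The comparison map `B ⊗_A Ext^n_{A^e}(X, A^e) ⊗_A B → Ext^n_{B^e}(B ⊗_A X ⊗_A B, B^e)`. -/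
def extComparison (X : BimodCat k A A) (n : ℕ) :
      (indFunctor φ).obj (extBim X n) ⟶ extBim ((indFunctor φ).obj X) n :=
  (indFunctor φ).map (extInd φ X n) ≫ (indAdj φ).counit.app (extBim ((indFunctor φ).obj X) n)

lemma extComparison_ind (X : BimodCat k A A) (n : ℕ) (e : extBim X n) :
    (extComparison φ X n).hom (ind φ 1 e 1) = (toExt ((indFunctor φ).obj X) n).symm (extIndHom φ X n e) := by
  change (indCounit φ (extBim ((indFunctor φ).obj X) n)).hom (ind φ 1 (res φ φ _
    ((toExt ((indFunctor φ).obj X) n).symm (extIndHom φ X n e))) 1) = _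
  rw [indCounit_ind, leftAct_one, rightAct_one, AddEquiv.symm_apply_apply]

lemma extComparison_naturality {X X' : BimodCat k A A} {m n p : ℕ} (x : Ext.{u} X' X m)
    (h : m + n = p) : (indFunctor φ).map (extPre x h) ≫ extComparison φ X' p =
      extComparison φ X n ≫ extPre (x.mapExactFunctor (indFunctor φ)) h :=
  induced_hom_ext φ fun e => by
    change (extComparison φ X' p).hom (ind φ 1 ((extPre x h).hom e) 1) =
      (extPre (x.mapExactFunctor (indFunctor φ)) h).hom ((extComparison φ X n).hom (ind φ 1 e 1))
    rw [extComparison_ind, extComparison_ind]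
    apply (toExt ((indFunctor φ).obj X') p).injective
    rw [AddEquiv.apply_symm_apply]
    refine Eq.trans ?_ (Ext.comp_assoc_of_third_deg_zero _ _ _ h)
    exact congrArg (fun y => Ext.comp y (Ext.mk₀ (indEnvHom φ)) (add_zero p))
      (Ext.mapExactFunctor_comp (indFunctor φ) x (toExt X n e) h)

lemma extComparison_naturality_mk₀ {X X' : BimodCat k A A} (f : X' ⟶ X) (n : ℕ) :
    (indFunctor φ).map (extPre (Ext.mk₀ f) (zero_add n)) ≫ extComparison φ X' n =
      extComparison φ X n ≫ extPre (Ext.mk₀ ((indFunctor φ).map f)) (zero_add n) := by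
  rw [extComparison_naturality, Ext.mapExactFunctor_mk₀]

/-- The map of bimodules `A^e → Hom(X, A^e)` that sends `1` to `c`. -/
def envExtHom (X : BimodCat k A A) (c : X ⟶ envRegular k A) : envRegular k A ⟶ extBim X 0 :=
  ModuleCat.ofHom (Y := (extBim X 0 : BimodCat k A A))
    (LinearMap.toSpanSingleton (A ⊗[k] Aᵐᵒᵖ) (extBim X 0)
    ((toExt X 0).symm (Ext.mk₀ c)))

lemma toExt_envExtHom (X : BimodCat k A A) (c : X ⟶ envRegular k A) (r : A ⊗[k] Aᵐᵒᵖ) :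
    toExt X 0 ((envExtHom X c).hom r) =
      Ext.mk₀ (c ≫ rightMulHom _ (envSwap k A r).unop) := by
  change toExt X 0 (r • _) = _
  rw [toExt_smul, AddEquiv.apply_symm_apply, Ext.mk₀_comp_mk₀]

instance isIso_envExtHom (X : BimodCat k A A) (c : X ⟶ envRegular k A) [IsIso c] :
    IsIso (envExtHom X c) := by
  rw [ConcreteCategory.isIso_iff_bijective]
  constructor
  · intro r s h
    have h := congrArg (toExt X 0) h
    rw [toExt_envExtHom, toExt_envExtHom] at h
    have h := (cancel_epi c).1 (Ext.homEquiv₀.symm.injective h)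
    have h : (envSwap k A r).unop = (envSwap k A s).unop := by
      simpa [rightMulHom] using congrArg (fun f => f.hom (1 : A ⊗[k] Aᵐᵒᵖ)) h
    exact (envSwap k A).injective (unop_injective h)
  · intro e
    obtain ⟨e, rfl⟩ := (toExt X 0).symm.surjective e
    obtain ⟨f, rfl⟩ := Ext.homEquiv₀.symm.surjective e
    refine ⟨(envSwap k A).symm (op ((inv c ≫ f).hom (1 : A ⊗[k] Aᵐᵒᵖ))), (toExt X 0).injective ?_⟩
    rw [toExt_envExtHom, AlgEquiv.apply_symm_apply, AddEquiv.apply_symm_apply]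
    refine congrArg Ext.mk₀ ?_
    rw [← IsIso.eq_inv_comp]
    refine ModuleCat.hom_ext (LinearMap.ext_ring ?_)
    simp [rightMulHom]

/-- The comparison map is an isomorphism in degree zero for the free bimodule of rank one. -/
lemma isIso_extComparison_envRegular : IsIso (extComparison φ (envRegular k A) 0) := by
  have h : (indFunctor φ).map (envExtHom (envRegular k A) (𝟙 _)) ≫
      extComparison φ (envRegular k A) 0 =
      indEnvHom φ ≫ envExtHom ((indFunctor φ).obj (envRegular k A)) (indEnvHom φ) :=
    induced_hom_ext φ fun r => by
      change (extComparison φ (envRegular k A) 0).hom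
        (ind φ 1 ((envExtHom (envRegular k A) (𝟙 _)).hom r) 1) =
        (envExtHom ((indFunctor φ).obj (envRegular k A)) (indEnvHom φ)).hom
          ((indEnvHom φ).hom (ind φ 1 (r : envRegular k A) 1))
      rw [extComparison_ind, indEnvHom_ind]
      apply (toExt _ 0).injective
      rw [AddEquiv.apply_symm_apply, extIndHom_apply, toExt_envExtHom, Ext.mapExactFunctor_mk₀,
        Category.id_comp]
      refine Eq.trans ?_ (toExt_envExtHom ((indFunctor φ).obj (envRegular k A)) (indEnvHom φ)
        (envMap φ r)).symm
      refine (Ext.mk₀_comp_mk₀ _ _).trans (congrArg Ext.mk₀ ?_)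
      exact (indEnvHom_rightMulHom φ _).trans
        (congrArg (fun s => indEnvHom φ ≫ rightMulHom _ s) (envSwap_envMap φ r).symm)
  have h' : IsIso ((indFunctor φ).map (envExtHom (envRegular k A) (𝟙 _)) ≫
      extComparison φ (envRegular k A) 0) := by
    rw [h]
    have : IsIso (C := BimodCat k B B) (X := (indFunctor φ).obj (envRegular k A)) (indEnvHom φ) :=
      isIso_indEnvHom φ
    exact IsIso.comp_isIso' this (isIso_envExtHom ((indFunctor φ).obj (envRegular k A)) _)
  exact IsIso.of_isIso_comp_left ((indFunctor φ).map (envExtHom (envRegular k A) (𝟙 _))) _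

/-- If the identity of `X` is a sum of maps that factor through `Y`, the comparison map is an
isomorphism for `X` if it is for `Y`. -/
lemma isIso_extComparison_of_sum_eq_id {X Y : BimodCat k A A} {ι : Type*} (s : Finset ι)
    (f : ι → (X ⟶ Y)) (g : ι → (Y ⟶ X)) (hfg : ∑ i ∈ s, f i ≫ g i = 𝟙 X) (n : ℕ)
    [IsIso (extComparison φ Y n)] : IsIso (extComparison φ X n) := by
  refine ⟨∑ i ∈ s, extPre (Ext.mk₀ ((indFunctor φ).map (g i))) (zero_add n) ≫
    inv (extComparison φ Y n) ≫ (indFunctor φ).map (extPre (Ext.mk₀ (f i)) (zero_add n)), ?_, ?_⟩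
  · rw [Preadditive.comp_sum]
    have h (i : ι) : extComparison φ X n ≫ extPre (Ext.mk₀ ((indFunctor φ).map (g i)))
        (zero_add n) ≫ inv (extComparison φ Y n) ≫
          (indFunctor φ).map (extPre (Ext.mk₀ (f i)) (zero_add n)) =
        (indFunctor φ).map (extPre (Ext.mk₀ (f i ≫ g i)) (zero_add n)) := by
      rw [← Category.assoc]
      refine (congrArg (fun y => y ≫ _) (extComparison_naturality_mk₀ φ (g i) n).symm).trans ?_
      rw [Category.assoc, ← extPre_comp, Functor.map_comp]
      refine congrArg (fun y => _ ≫ y) ?_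
      exact IsIso.hom_inv_id_assoc (extComparison φ Y n) _
    rw [Finset.sum_congr rfl fun i _ => h i, ← Functor.map_sum, extPre_sum, hfg, extPre_id]
    exact (indFunctor φ).map_id _
  · rw [Preadditive.sum_comp]
    have h (i : ι) : (extPre (Ext.mk₀ ((indFunctor φ).map (g i))) (zero_add n) ≫
        inv (extComparison φ Y n) ≫ (indFunctor φ).map (extPre (Ext.mk₀ (f i)) (zero_add n))) ≫
          extComparison φ X n =
        extPre (Ext.mk₀ ((indFunctor φ).map (f i ≫ g i))) (zero_add n) := by
      rw [Category.assoc, Category.assoc, Functor.map_comp]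
      refine Eq.trans ?_ (extPre_comp _ _ n)
      refine congrArg (fun y => _ ≫ y) ?_
      rw [IsIso.inv_comp_eq]
      exact extComparison_naturality_mk₀ φ (f i) n
    rw [Finset.sum_congr rfl fun i _ => h i, extPre_sum, ← Functor.map_sum, hfg]
    refine Eq.trans ?_ (extPre_id ((indFunctor φ).obj X) n)
    rw [CategoryTheory.Functor.map_id]

end ExtInduction

/-! #### Dimension shifting -/

section Syzygies

open Abelian

variable {k : Type w} [Field k] {A B : Type u} [Ring A] [Algebra k A] [Ring B] [Algebra k B]
  (φ : A →ₐ[k] B) [Limits.PreservesFiniteLimits (indFunctor φ)]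

lemma isIso_extComparison_of_iso {X Y : BimodCat k A A} (e : X ≅ Y) (n : ℕ)
    [IsIso (extComparison φ Y n)] : IsIso (extComparison φ X n) :=
  isIso_extComparison_of_sum_eq_id φ {()} (fun _ => e.hom) (fun _ => e.inv) (by simp) n

/-- For a finitely generated projective `X`, the comparison map in degree zero is an isomorphism,
since `X` is a direct summand of a finite free module. -/
lemma isIso_extComparison_of_projective (X : BimodCat k A A) [Projective X]
    [Module.Finite (A ⊗[k] Aᵐᵒᵖ) X] : IsIso (extComparison φ X 0) := by
  obtain ⟨n, p, hp⟩ := Module.Finite.exists_fin' (A ⊗[k] Aᵐᵒᵖ) X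
  have : Module.Projective (A ⊗[k] Aᵐᵒᵖ) X := (IsProjective.iff_projective _).2 inferInstance
  obtain ⟨s, hs⟩ := Module.projective_lifting_property p LinearMap.id hp
  have := isIso_extComparison_envRegular φ
  refine isIso_extComparison_of_sum_eq_id φ Finset.univ (Y := envRegular k A)
    (fun i => ModuleCat.ofHom (LinearMap.proj i ∘ₗ s))
    (fun i => ModuleCat.ofHom (p ∘ₗ LinearMap.single _ (fun _ => A ⊗[k] Aᵐᵒᵖ) i)) ?_ 0
  refine ModuleCat.hom_ext (LinearMap.ext fun x => ?_)
  rw [ModuleCat.hom_sum, LinearMap.sum_apply]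
  refine Eq.trans ?_ (LinearMap.congr_fun hs x)
  refine Eq.trans ?_ (congrArg p (LinearMap.sum_single_apply (φ := fun _ => A ⊗[k] Aᵐᵒᵖ) (s x)))
  rw [map_sum]
  rfl

/-- If the comparison map in degree zero is an isomorphism for `Y`, it is injective for every
quotient of `Y`, since `Hom(-, A^e)` is left exact and induction preserves injectivity. -/
lemma mono_extComparison {X Y : BimodCat k A A} (g : Y ⟶ X) [Epi g]
    [IsIso (extComparison φ Y 0)] : Mono (extComparison φ X 0) := by
  have h : Mono (extPre (Ext.mk₀ g) (zero_add 0)) :=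
    (ModuleCat.mono_iff_injective _).2 (Ext.precomp_mk₀_injective_of_epi (envRegular k A) g)
  have : Mono (extComparison φ X 0 ≫
      extPre (Ext.mk₀ ((indFunctor φ).map g)) (zero_add 0)) :=
    extComparison_naturality_mk₀ φ g 0 ▸ inferInstance
  exact mono_of_mono (extComparison φ X 0)
    (extPre (Ext.mk₀ ((indFunctor φ).map g)) (zero_add 0))

lemma exact_indFunctor_map {X Y Z : BimodCat k A A} (f : X ⟶ Y) (g : Y ⟶ Z)
    (h : Function.Exact f.hom g.hom) :
    Function.Exact ((indFunctor φ).map f).hom ((indFunctor φ).map g).hom := by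
  have w : f ≫ g = 0 := ModuleCat.hom_ext (LinearMap.ext h.apply_apply_eq_zero)
  have := ((ShortComplex.ShortExact.moduleCat_exact_iff_function_exact
    (ShortComplex.mk f g w)).2 h).map (indFunctor φ)
  exact (ShortComplex.ShortExact.moduleCat_exact_iff_function_exact _).1 this

section ShortExact

variable {S : ShortComplex (BimodCat k A A)} (hS : S.ShortExact)

include hS

/-- The five lemma for the sequence `0 → Hom(X₃, A^e) → Hom(X₂, A^e) → Hom(X₁, A^e)`. -/
lemma isIso_extComparison_zero [IsIso (extComparison φ S.X₂ 0)] [Mono (extComparison φ S.X₁ 0)] :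
    IsIso (extComparison φ S.X₃ 0) := by
  have h₁ := (ConcreteCategory.isIso_iff_bijective (extComparison φ S.X₂ 0)).1 inferInstance
  have h₂ := (ModuleCat.mono_iff_injective (extComparison φ S.X₁ 0)).1 inferInstance
  have := hS.epi_g
  have h₃ : Mono (extPre (Ext.mk₀ S.g) (zero_add 0)) :=
    (ModuleCat.mono_iff_injective _).2 (Ext.precomp_mk₀_injective_of_epi (envRegular k A) S.g)
  have ex {R : Type u} [Ring R] [Algebra k R] {S : ShortComplex (BimodCat k R R)}
      (hS : S.ShortExact) : Function.Exact (extPre (Ext.mk₀ S.g) (zero_add 0)).hom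
        (extPre (Ext.mk₀ S.f) (zero_add 0)).hom :=
    (ShortComplex.ab_exact_iff_function_exact _).1
      (Ext.contravariant_sequence_exact₂' hS (envRegular k R) 0)
  rw [ConcreteCategory.isIso_iff_bijective]
  exact AddMonoidHom.bijective_of_bijective_of_injective_of_left_exact
    ((indFunctor φ).map (extPre (Ext.mk₀ S.g) (zero_add 0))).hom.toAddMonoidHom
    ((indFunctor φ).map (extPre (Ext.mk₀ S.f) (zero_add 0))).hom.toAddMonoidHom
    (extPre (Ext.mk₀ ((indFunctor φ).map S.g)) (zero_add 0)).hom.toAddMonoidHom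
    (extPre (Ext.mk₀ ((indFunctor φ).map S.f)) (zero_add 0)).hom.toAddMonoidHom
    (extComparison φ S.X₃ 0).hom.toAddMonoidHom (extComparison φ S.X₂ 0).hom.toAddMonoidHom
    (extComparison φ S.X₁ 0).hom.toAddMonoidHom
    (AddMonoidHom.ext fun y =>
      congrArg (fun f => f.hom y) (extComparison_naturality_mk₀ φ S.g 0).symm)
    (AddMonoidHom.ext fun y =>
      congrArg (fun f => f.hom y) (extComparison_naturality_mk₀ φ S.f 0).symm)
    (exact_indFunctor_map φ _ _ (ex hS)) (ex (hS.map_of_exact (indFunctor φ))) h₁ h₂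
    ((ModuleCat.mono_iff_injective _).1 inferInstance)
    (Ext.precomp_mk₀_injective_of_epi (envRegular k B) ((indFunctor φ).map S.g))

/-- The five lemma for the sequence `Ext^n(X₂, A^e) → Ext^n(X₁, A^e) → Ext^{n+1}(X₃, A^e) → 0`,
which is exact when `X₂` is projective. -/
lemma isIso_extComparison_succ [Projective S.X₂] (n : ℕ) (h₂ : Epi (extComparison φ S.X₂ n))
    [IsIso (extComparison φ S.X₁ n)] : IsIso (extComparison φ S.X₃ (n + 1)) := by
  have h₁ := (ConcreteCategory.isIso_iff_bijective (extComparison φ S.X₁ n)).1 inferInstance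
  have : Projective (S.map (indFunctor φ)).X₂ :=
    Functor.PreservesProjectiveObjects.projective_obj (F := indFunctor φ) inferInstance
  have hS' := hS.map_of_exact (indFunctor φ)
  have ex {R : Type u} [Ring R] [Algebra k R] {S : ShortComplex (BimodCat k R R)}
      (hS : S.ShortExact) : Function.Exact (extPre (Ext.mk₀ S.f) (zero_add n)).hom
        (extPre hS.extClass (add_comm 1 n)).hom :=
    ext_exact hS (envRegular k R) n
  have h₃ : Epi (extPre hS.extClass (add_comm 1 n)) :=
    (ModuleCat.epi_iff_surjective _).2 (extClass_precomp_surjective hS (envRegular k A) n)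
  rw [ConcreteCategory.isIso_iff_bijective]
  exact AddMonoidHom.bijective_of_surjective_of_bijective_of_right_exact
    ((indFunctor φ).map (extPre (Ext.mk₀ S.f) (zero_add n))).hom.toAddMonoidHom
    ((indFunctor φ).map (extPre hS.extClass (add_comm 1 n))).hom.toAddMonoidHom
    (extPre (Ext.mk₀ ((indFunctor φ).map S.f)) (zero_add n)).hom.toAddMonoidHom
    (extPre hS'.extClass (add_comm 1 n)).hom.toAddMonoidHom
    (extComparison φ S.X₂ n).hom.toAddMonoidHom (extComparison φ S.X₁ n).hom.toAddMonoidHom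
    (extComparison φ S.X₃ (n + 1)).hom.toAddMonoidHom
    (AddMonoidHom.ext fun y =>
      congrArg (fun f => f.hom y) (extComparison_naturality_mk₀ φ S.f n).symm)
    (AddMonoidHom.ext fun y => by
      have h := extComparison_naturality φ hS.extClass (add_comm 1 n)
      rw [Ext.mapExactFunctor_extClass] at h
      exact congrArg (fun f => f.hom y) h.symm)
    (exact_indFunctor_map φ _ _ (ex hS)) (ex hS')
    ((ModuleCat.epi_iff_surjective _).1 h₂) h₁
    ((ModuleCat.epi_iff_surjective _).1 inferInstance)
    (extClass_precomp_surjective hS' (envRegular k B) n)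

end ShortExact

lemma epi_extComparison_succ (X : BimodCat k A A) [Projective X] (n : ℕ) :
    Epi (extComparison φ X (n + 1)) := by
  rw [ModuleCat.epi_iff_surjective]
  have : Projective ((indFunctor φ).obj X) :=
    Functor.PreservesProjectiveObjects.projective_obj inferInstance
  have : Subsingleton (Ext.{u} ((indFunctor φ).obj X) (envRegular k B) (n + 1)) :=
    Ext.subsingleton_of_projective _ _ _
  exact fun y => ⟨0, (toExt ((indFunctor φ).obj X) (n + 1)).injective (Subsingleton.elim _ _)⟩

/-- Dimension shifting along a resolution, given by its short exact sequences of syzygies. -/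
lemma isIso_extComparison_of_shortExact (S : ℕ → ShortComplex (BimodCat k A A))
    (hS : ∀ i, (S i).ShortExact) (e : ∀ i, (S i).X₁ ≅ (S (i + 1)).X₃)
    [∀ i, Projective (S i).X₂] [∀ i, Module.Finite (A ⊗[k] Aᵐᵒᵖ) (S i).X₂] (n i : ℕ) :
    IsIso (extComparison φ (S i).X₃ n) := by
  have h₂ (i : ℕ) : IsIso (extComparison φ (S i).X₂ 0) := isIso_extComparison_of_projective φ _
  induction n generalizing i with
  | zero =>
    have := (hS (i + 1)).epi_g
    have : Mono (extComparison φ (S i).X₁ 0) :=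
      mono_extComparison φ ((S (i + 1)).g ≫ (e i).inv)
    exact isIso_extComparison_zero φ (hS i)
  | succ n hn =>
    have := hn (i + 1)
    have := isIso_extComparison_of_iso φ (e i) n
    refine isIso_extComparison_succ φ (hS i) n ?_
    cases n with
    | zero => infer_instance
    | succ n => exact epi_extComparison_succ φ _ n

/-- The short exact sequence `0 → Z_{i+1} → P_i → Z_i → 0` of syzygies of a projective
resolution, where `Z_i` is the cokernel of `P_{i+1} → P_i`. -/
def syzygy {C : Type*} [Category* C] [Abelian C] {Z : C} (P : ProjectiveResolution Z) (i : ℕ) :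
    ShortComplex C :=
  ShortComplex.mk (X₁ := Limits.cokernel (P.complex.d (i + 2) (i + 1)))
    (Limits.cokernel.desc _ (P.complex.d (i + 1) i) (P.complex.d_comp_d _ _ _))
    (Limits.cokernel.π (P.complex.d (i + 1) i))
    (by rw [← cancel_epi (Limits.cokernel.π _)]; simp)

lemma syzygy_shortExact {C : Type*} [Category* C] [Abelian C] {Z : C}
    (P : ProjectiveResolution Z) (i : ℕ) : (syzygy P i).ShortExact where
  exact := by
    let S := ShortComplex.mk (P.complex.d (i + 1) i) (Limits.cokernel.π (P.complex.d (i + 1) i))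
      (Limits.cokernel.condition _)
    let f : S ⟶ syzygy P i :=
      { τ₁ := Limits.cokernel.π (P.complex.d (i + 2) (i + 1))
        τ₂ := 𝟙 _
        τ₃ := 𝟙 _
        comm₁₂ := by simp [S, syzygy]
        comm₂₃ := by simp [S, syzygy] }
    have : Epi f.τ₁ := inferInstanceAs (Epi (Limits.cokernel.π _))
    have : IsIso f.τ₂ := inferInstanceAs (IsIso (𝟙 _))
    have : Mono f.τ₃ := inferInstanceAs (Mono (𝟙 _))
    exact (ShortComplex.exact_iff_of_epi_of_isIso_of_mono f).1 (ShortComplex.exact_cokernel _)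
  mono_f := (P.exact_succ i).mono_cokernelDesc
  epi_g := inferInstanceAs (Epi (Limits.cokernel.π (P.complex.d (i + 1) i)))

/-- If `X` has a resolution by finitely generated projectives, then
`B ⊗_A Ext^n_{A^e}(X, A^e) ⊗_A B = Ext^n_{B^e}(B ⊗_A X ⊗_A B, B^e)`. -/
lemma isIso_extComparison {X : BimodCat k A A} (P : ProjectiveResolution X)
    [hP : ∀ i, Module.Finite (A ⊗[k] Aᵐᵒᵖ) (P.complex.X i)] (n : ℕ) :
    IsIso (extComparison φ X n) := by
  have : ∀ i, Projective (syzygy P i).X₂ := P.projective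
  have : ∀ i, Module.Finite (A ⊗[k] Aᵐᵒᵖ) (syzygy P i).X₂ := hP
  have := isIso_extComparison_of_shortExact φ (syzygy P) (syzygy_shortExact P)
    (fun i => Iso.refl _) n 0
  let e : X ≅ (syzygy P 0).X₃ := Limits.IsColimit.coconePointUniqueUpToIso
    P.isColimitCokernelCofork (Limits.colimit.isColimit _)
  exact isIso_extComparison_of_iso φ e n

end Syzygies

/-! ### Stability of the class `VdB(d)` -/

section Stability

/-- Transport of a projective resolution along an isomorphism. -/
def _root_.CategoryTheory.ProjectiveResolution.ofIso {C : Type*} [Category* C] [Abelian C]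
    {Z Z' : C} (P : ProjectiveResolution Z) (e : Z ≅ Z') : ProjectiveResolution Z' where
  complex := P.complex
  π := P.π ≫ (ChainComplex.single₀ C).map e.hom
  quasiIso := inferInstance

variable {k : Type w} [Field k] {A B : Type u} [Ring A] [Algebra k A] [Ring B] [Algebra k B]
  (φ : A →ₐ[k] B) [Limits.PreservesFiniteLimits (indFunctor φ)]

lemma hasFGProjectiveResolution_of_localization (hmul : Function.Injective (mulMap φ))
    (h : HasFGProjectiveResolution k A) : HasFGProjectiveResolution k B := by
  obtain ⟨P, hP⟩ := h
  exact ⟨((indFunctor φ).mapProjectiveResolution P).ofIso (indRegular φ hmul),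
    fun n => finite_induced φ (P.complex.X n)⟩

/-- The homology of `A` with coefficients in `U ⊗_A M`, for a `B`-bimodule `M`, is the homology of
`B` with coefficients in `(B ⊗_A U ⊗_A B) ⊗_B M`. -/
def twistedHomologyIso {U : BimodCat k A A} (hmul : Function.Injective (mulMap φ))
    (σ : tensor (resB φ) U ≅ tensor U (resB φ)) (j : ℕ) :
    (resFunctor φ ⋙ tensorFunctor A U) ⋙ hochschildHomology k A j ≅
      tensorFunctor B (induced φ U) ⋙ hochschildHomology k B j :=
  Functor.isoWhiskerRight (inducedTensorFunctorIso hmul σ).symm (hochschildHomology k A j) ≪≫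
    Functor.associator _ _ _ ≪≫
    Functor.isoWhiskerLeft (tensorFunctor B (induced φ U)) (homologyIso φ hmul j)

lemma satisfiesDuality_induced {U : BimodCat k A A} {d : ℤ}
    (hmul : Function.Injective (mulMap φ)) (σ : tensor (resB φ) U ≅ tensor U (resB φ))
    (h : SatisfiesDuality U d) : SatisfiesDuality (induced φ U) d where
  iso n j hnj := by
    obtain ⟨e⟩ := h.iso n j hnj
    exact ⟨(cohomologyIso φ hmul n).symm ≪≫ Functor.isoWhiskerLeft (resFunctor φ) e ≪≫
      twistedHomologyIso φ hmul σ j⟩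
  cohomology_zero n hn M := by
    have : Subsingleton ((resFunctor φ ⋙ hochschildCohomology k A n).obj M) :=
      h.cohomology_zero n hn ((resFunctor φ).obj M)
    exact ((cohomologyIso φ hmul n).app M).toLinearEquiv.symm.injective.subsingleton
  homology_zero j hj M := by
    have : Subsingleton (((resFunctor φ ⋙ tensorFunctor A U) ⋙ hochschildHomology k A j).obj M) :=
      h.homology_zero j hj ((resFunctor φ).obj M)
    exact ((twistedHomologyIso φ hmul σ j).app M).toLinearEquiv.symm.injective.subsingleton

/-- `B ⊗_A Ext^n_{A^e}(A, A^e) ⊗_A B ≅ Ext^n_{B^e}(B, B^e)`. -/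
lemma nonempty_induced_extBimodule_iso (hmul : Function.Injective (mulMap φ))
    (h : HasFGProjectiveResolution k A) (n : ℕ) :
    Nonempty (induced φ (extBimodule k A n) ≅ extBimodule k B n) := by
  obtain ⟨P, hP⟩ := h
  have := isIso_extComparison φ P n
  let e : (indFunctor φ).obj (extBim (regular k A) n) ≅
      extBim ((indFunctor φ).obj (regular k A)) n := asIso (extComparison φ (regular k A) n)
  exact ⟨e ≪≫ extBimIso (indRegular φ hmul) n⟩

lemma satisfiesExt_induced {U : BimodCat k A A} {d : ℤ} (hmul : Function.Injective (mulMap φ))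
    (hA : HasFGProjectiveResolution k A) (h : SatisfiesExt U d) :
    SatisfiesExt (induced φ U) d where
  finite_dim := by
    obtain ⟨n, hn⟩ := h.finite_dim
    exact ⟨n, hasProjectiveDimensionLE_regular φ hmul n⟩
  ext_zero n hn := by
    have := h.ext_zero n hn
    obtain ⟨e⟩ := nonempty_induced_extBimodule_iso φ hmul hA n
    have h₀ : Limits.IsZero ((indFunctor φ).obj (extBimodule k A n)) :=
      (indFunctor φ).map_isZero (ModuleCat.isZero_of_subsingleton _)
    exact ModuleCat.subsingleton_of_isZero (h₀.of_iso e.symm)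
  ext_iso n hn := by
    obtain ⟨e⟩ := h.ext_iso n hn
    obtain ⟨e'⟩ := nonempty_induced_extBimodule_iso φ hmul hA n
    exact ⟨e'.symm ≪≫ (indFunctor φ).mapIso e⟩

end Stability

end VdB

end

theorem mainTheorem2 {k : Type w} [Field k] [CharZero k] {A B : Type u} [Ring A] [Algebra k A]
    [Ring B] [Algebra k B] (φ : A →ₐ[k] B) (d : ℤ) (U : VdB.BimodCat k A A)
    (hleft : VdB.TensorLeftExact φ) (hright : VdB.TensorRightExact φ)
    (hmul : Function.Bijective (VdB.mulMap φ))
    (hcomm : Nonempty (VdB.tensor (VdB.bimodAA φ) U ≅ VdB.tensor U (VdB.bimodAA φ))) :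
    (VdB.InVdBDuality U d → VdB.InVdBDuality (VdB.induced φ U) d) ∧
    (VdB.InVdBExt U d → VdB.InVdBExt (VdB.induced φ U) d) ∧
    Nonempty (VdB.tensor (VdB.bimodBA φ) U ≅
      VdB.restrict (AlgHom.id k B) φ (VdB.induced φ U)) := by
  obtain ⟨σ⟩ := hcomm
  have := VdB.preservesFiniteLimits_indFunctor hleft hright
  have hres := VdB.hasFGProjectiveResolution_of_localization φ hmul.1
  refine ⟨fun h => ⟨hres h.resolution, ?_, ?_⟩, fun h => ⟨hres h.resolution, ?_, ?_⟩, ⟨?_⟩⟩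
  · exact VdB.isInvertible_induced hmul.1 h.invertible σ
  · exact VdB.satisfiesDuality_induced φ hmul.1 σ h.duality
  · exact VdB.isInvertible_induced hmul.1 h.invertible σ
  · exact VdB.satisfiesExt_induced φ hmul.1 h.resolution h.ext
  · exact VdB.tensorIsoRestrictInduced hmul.1 σ
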